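/- Let $G$ be a directed graph with vertex set $VG$ and edge set $EG$ (multiple edges allowed; $VG$, $EG$ may be infinite), with origin and terminus maps $o,t$, in which every vertex is the origin of only finitely many edges, and let $R$ be a root of $G$, i.e. every vertex of $G$ is reached by a directed walk starting at $R$; let $(H,S)$ be another such rooted graph. *Leavitt path algebra.* $L_{\mathbb Z}(G)$ is the (not necessarily unital) ring generated by the vertices $v\in VG$, the edges $e$ and the reversed edges $e^*$ ($e\in EG$), subject to: $vw=\delta_{v,w}v$ for vertices $v,w$; $o(e)e=e\,t(e)=e$ and $t(e)e^*=e^*o(e)=e^*$; $e^*f=\delta_{e,f}\,t(e)$ for edges $e,f$; and $v=\sum_{o(e)=v}ee^*$ for every vertex $v$ that is the origin of at least one edge. It carries the involution $*$ with $v^*=v$, $(e^*)^*=e$, $(xy)^*=y^*x^*$. A walk $p=e_1\cdots e_n$ is identified with the product of its edges, and the empty walk $\epsilon_v$ at a vertex $v$ with $v$. The rooted Leavitt path algebra $L_{\mathbb Z}(G,R)$ is the $*$-subalgebra of $L_{\mathbb Z}(G)$ spanned over $\mathbb Z$ by the elements $pq^*$, where $p,q$ are walks originating in $R$ with the same terminal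 vertex. *Higman–Thompson group.* The unfolding tree $\mathcal T(G,R)$ has the walks originating in $R$ as vertices and the pairs $(p,pe)$, $e\in EG$, as edges; its vertices are ordered by the prefix order. A cofinite subspace is a set $\mathcal S$ of vertices of $\mathcal T(G,R)$ with finite complement that is closed under passing to extensions and contains an extension of every vertex of $\mathcal T(G,R)$ (the last condition is automatic if $G$ has no sinks, i.e. if every vertex is the origin of an edge); its basis $B$ is the set of its minimal elements. A Higman–Thompson representative is an isomorphism $\phi:\mathcal S\to\mathcal S'$ between two cofinite subspaces such that, for each $b$ in the basis of $\mathcal S$, the walks $b$ and $\phi(b)$ have the same terminal vertex (again automatic if $G$ has no sinks) and $\phi(bp)=\phi(b)p$ for every walk $p$ originating there. Two representatives are equivalent if they agree on some cofinite subspace. The Higman–Thompson group $\mathcal{HT}(\mathcal T(G,R))$ is the group of equivalence classes of Higman–Thompson representatives under composition (on the cofinite subspaces where it is defined); it is a subgroup of the group of almost automorphisms of $\mathcal T(G,R)$, the equivalence classes of all isomorphisms between cofinite subspaces. **Theorem.** If there exists a $*$-isomorphism $\phi: L_{\mathbb Z}(G,R)\to L_{\mathbb Z}(H,S)$, then $$\mathcal{HT}(\mathcal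 T(G,R))\cong\mathcal{HT}(\mathcal T(H,S)).$$ -/

import Mathlib

/-- A directed graph with multiple edges: `V` is the vertex set, `E` the edge set, and
`o`, `t` are the origin and terminus functions. -/
structure DirectedMultigraph (V : Type*) (E : Type*) where
  o : E → V
  t : E → V

namespace DirectedMultigraph

universe u v

variable {V : Type u} {E : Type v}

/-! ### Walks and rooted graphs -/

/-- `G.IsWalk v l`: the list of edges `l` is a walk in `G` originating in `v`
(the empty list is the empty walk based at `v`). -/
def IsWalk (G : DirectedMultigraph V E) : V → List E → Prop
  | _, [] => True
  | v, e :: l => G.o e = v ∧ G.IsWalk (G.t e) l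

/-- The terminal vertex of the walk `l` originating in `v`. -/
def terminus (G : DirectedMultigraph V E) : V → List E → V
  | v, [] => v
  | _, e :: l => G.terminus (G.t e) l

/-- `R` is a root of `G`: every vertex (hence also every edge) can be reached by a walk
originating in `R`. -/
def IsRoot (G : DirectedMultigraph V E) (R : V) : Prop :=
  ∀ v, ∃ l, G.IsWalk R l ∧ G.terminus R l = v

/-- Every vertex is the origin of only finitely many edges. -/
def RowFinite (G : DirectedMultigraph V E) : Prop :=
  ∀ v, {e : E | G.o e = v}.Finite

theorem isWalk_append (G : DirectedMultigraph V E) (v : V) (l m : List E) :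
    G.IsWalk v (l ++ m) ↔ G.IsWalk v l ∧ G.IsWalk (G.terminus v l) m := by
  induction l generalizing v with
  | nil => simp [IsWalk, terminus]
  | cons e l ih => simp [IsWalk, terminus, ih, and_assoc]

theorem terminus_append (G : DirectedMultigraph V E) (v : V) (l m : List E) :
    G.terminus v (l ++ m) = G.terminus (G.terminus v l) m := by
  induction l generalizing v with
  | nil => rfl
  | cons e l ih => simp [terminus, ih]

/-! ### The unfolding tree -/

/-- The vertices of the unfolding tree of `G` based on `R`: the walks originating in `R`. The edges
of the tree are the pairs `(p, pe)`; equivalently, they are the covering pairs of the prefix order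
below. -/
def UnfoldingTree (G : DirectedMultigraph V E) (R : V) : Type v :=
  {l : List E // G.IsWalk R l}

variable {G : DirectedMultigraph V E} {R : V}

namespace UnfoldingTree

/-- The prefix order: `p ≤ q` iff `q = p r` for some `r`. -/
instance : PartialOrder (G.UnfoldingTree R) where
  le p q := p.1 <+: q.1
  le_refl p := List.prefix_refl p.1
  le_trans _ _ _ h k := List.IsPrefix.trans h k
  le_antisymm _ _ h k := Subtype.ext (h.eq_of_length (le_antisymm h.length_le k.length_le))

/-- The terminal vertex in `G` of a walk, regarded as a vertex of the unfolding tree. -/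
def terminus (p : G.UnfoldingTree R) : V := G.terminus R p.1

theorem le_iff {p q : G.UnfoldingTree R} : p ≤ q ↔ ∃ w, p.1 ++ w = q.1 := Iff.rfl

/-- A set of vertices of the tree is a cofinite (inescapable) subspace if its complement is finite,
it is closed under passing to extensions, and every vertex of the tree has an extension in it.
The last condition is automatic if `G` has no sinks. -/
structure IsCofiniteSubspace (S : Set (G.UnfoldingTree R)) : Prop where
  finite_compl : Sᶜ.Finite
  mem_of_le : ∀ p ∈ S, ∀ q, p ≤ q → q ∈ S
  inescapable : ∀ p, ∃ s ∈ S, p ≤ s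

/-- The basis of a subspace: its minimal elements. This is the unique independent subset `B` of `S`
such that each element of `S` has a prefix in `B`. -/
def basis (S : Set (G.UnfoldingTree R)) : Set (G.UnfoldingTree R) :=
  {b | Minimal (· ∈ S) b}

theorem exists_basis_le {S : Set (G.UnfoldingTree R)} {p : G.UnfoldingTree R} (hp : p ∈ S) :
    ∃ b ∈ basis S, b ≤ p := by
  induction hn : p.1.length using Nat.strong_induction_on generalizing p with
  | _ n ih =>
    by_cases h : p ∈ basis S
    · exact ⟨p, h, le_rfl⟩
    · have : ∃ q ∈ S, q ≤ p ∧ ¬ p ≤ q := by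
        by_contra! hc
        exact h ⟨hp, fun q hq hqp => hc q hq hqp⟩
      obtain ⟨q, hq, hqp, hpq⟩ := this
      have hlt : q.1.length < n := by
        subst hn
        refine lt_of_le_of_ne (List.IsPrefix.length_le hqp) fun he => hpq ?_
        have : q = p := Subtype.ext (List.IsPrefix.eq_of_length hqp he)
        exact this.ge
      obtain ⟨b, hb, hbq⟩ := ih _ hlt hq rfl
      exact ⟨b, hb, hbq.trans hqp⟩

theorem IsCofiniteSubspace.univ : IsCofiniteSubspace (Set.univ : Set (G.UnfoldingTree R)) where
  finite_compl := by simp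
  mem_of_le := by simp
  inescapable p := ⟨p, trivial, le_rfl⟩

theorem IsCofiniteSubspace.inter {S T : Set (G.UnfoldingTree R)} (hS : IsCofiniteSubspace S)
    (hT : IsCofiniteSubspace T) : IsCofiniteSubspace (S ∩ T) where
  finite_compl := by
    rw [Set.compl_inter]
    exact hS.finite_compl.union hT.finite_compl
  mem_of_le p hp q hpq := ⟨hS.mem_of_le p hp.1 q hpq, hT.mem_of_le p hp.2 q hpq⟩
  inescapable p := by
    obtain ⟨s, hs, hps⟩ := hS.inescapable p
    obtain ⟨t, ht, hst⟩ := hT.inescapable s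
    exact ⟨t, ⟨hS.mem_of_le s hs t hst, ht⟩, hps.trans hst⟩

end UnfoldingTree

open UnfoldingTree

/-! ### Almost automorphisms -/

/-- An almost automorphism representative: an isomorphism between two cofinite subspaces of the
unfolding tree. (A bijection between two such subspaces preserves the tree edges in both directions
iff it preserves the prefix order in both directions.) It is recorded as a partial bijection with
these subspaces as source and target; its values outside of the source play no role. -/
structure Representative (G : DirectedMultigraph V E) (R : V) extends
    PartialEquiv (G.UnfoldingTree R) (G.UnfoldingTree R) where
  source_cofinite : IsCofiniteSubspace source
  target_cofinite : IsCofiniteSubspace target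
  map_le_iff : ∀ p ∈ source, ∀ q ∈ source, toFun p ≤ toFun q ↔ p ≤ q

namespace Representative

/-- A Higman–Thompson representative: for each `b` in the basis of the domain and each walk `w`
originating in the terminal vertex of `b`, the image of `b w` is the image of `b` followed by `w`,
where the image of `b` has the same terminal vertex as `b`. -/
def IsHigmanThompson (φ : Representative G R) : Prop :=
  ∀ b ∈ basis φ.source,
    (φ.toPartialEquiv b).terminus = b.terminus ∧
    ∀ (w : List E) (q : G.UnfoldingTree R), q.1 = b.1 ++ w →
      (φ.toPartialEquiv q).1 = (φ.toPartialEquiv b).1 ++ w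

theorem isHigmanThompson_iff (φ : Representative G R) : φ.IsHigmanThompson ↔
    ∀ p ∈ φ.source, (φ.toPartialEquiv p).terminus = p.terminus ∧
      ∀ (w : List E) (q : G.UnfoldingTree R), q.1 = p.1 ++ w →
        (φ.toPartialEquiv q).1 = (φ.toPartialEquiv p).1 ++ w := by
  refine ⟨fun h p hp => ?_, fun h b hb => h b hb.1⟩
  obtain ⟨b, hb, u, hu⟩ := exists_basis_le hp
  obtain ⟨h1, h2⟩ := h b hb
  have hp' := h2 u p hu.symm
  refine ⟨?_, fun w q hq => ?_⟩
  · unfold UnfoldingTree.terminus at h1 ⊢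
    rw [hp', ← hu, terminus_append, terminus_append, h1]
  · rw [h2 (u ++ w) q (by rw [hq, ← hu, List.append_assoc]), hp', List.append_assoc]

/-- Two representatives are equivalent if they agree on some cofinite subspace. -/
instance setoid (G : DirectedMultigraph V E) (R : V) : Setoid (Representative G R) where
  r φ ψ := ∃ S, IsCofiniteSubspace S ∧ S ⊆ φ.source ∧ S ⊆ ψ.source ∧
    Set.EqOn φ.toPartialEquiv ψ.toPartialEquiv S
  iseqv :=
    { refl := fun φ => ⟨φ.source, φ.source_cofinite, le_rfl, le_rfl, fun _ _ => rfl⟩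
      symm := fun ⟨S, hS, h1, h2, h⟩ => ⟨S, hS, h2, h1, h.symm⟩
      trans := fun ⟨S, hS, h1, _, h⟩ ⟨T, hT, _, k2, k⟩ =>
        ⟨S ∩ T, hS.inter hT, fun _ x => h1 x.1, fun _ x => k2 x.2,
          fun _ x => (h x.1).trans (k x.2)⟩ }

theorem cofinite_preimage (φ : Representative G R) {S : Set (G.UnfoldingTree R)}
    (hS : IsCofiniteSubspace S) :
    IsCofiniteSubspace (φ.source ∩ φ.toPartialEquiv ⁻¹' S) where
  finite_compl := by
    refine (φ.source_cofinite.finite_compl.union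
      (hS.finite_compl.image φ.toPartialEquiv.symm)).subset fun x hx => ?_
    by_cases hxs : x ∈ φ.source
    · exact Or.inr ⟨φ.toPartialEquiv x, fun h => hx ⟨hxs, h⟩, φ.left_inv hxs⟩
    · exact Or.inl hxs
  mem_of_le p hp q hpq := by
    have hq := φ.source_cofinite.mem_of_le p hp.1 q hpq
    exact ⟨hq, hS.mem_of_le _ hp.2 _ ((φ.map_le_iff p hp.1 q hq).2 hpq)⟩
  inescapable p := by
    obtain ⟨s, hs, hps⟩ := φ.source_cofinite.inescapable p
    obtain ⟨t, ht, hst⟩ := hS.inescapable (φ.toPartialEquiv s)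
    have htt : t ∈ φ.target := φ.target_cofinite.mem_of_le _ (φ.map_source hs) t hst
    have hm := φ.map_target htt
    have he : φ.toPartialEquiv (φ.toPartialEquiv.symm t) = t := φ.right_inv htt
    refine ⟨φ.toPartialEquiv.symm t, ⟨hm, ?_⟩, hps.trans ?_⟩
    · change φ.toPartialEquiv (φ.toPartialEquiv.symm t) ∈ S
      rwa [he]
    · refine (φ.map_le_iff s hs _ hm).1 ?_
      rwa [he]

/-- The identity representative. -/
def one (G : DirectedMultigraph V E) (R : V) : Representative G R where
  toPartialEquiv := PartialEquiv.refl _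
  source_cofinite := IsCofiniteSubspace.univ
  target_cofinite := IsCofiniteSubspace.univ
  map_le_iff _ _ _ _ := Iff.rfl

/-- The inverse representative. -/
def inv (φ : Representative G R) : Representative G R where
  toPartialEquiv := φ.toPartialEquiv.symm
  source_cofinite := φ.target_cofinite
  target_cofinite := φ.source_cofinite
  map_le_iff p hp q hq := by
    have hp' : φ.toPartialEquiv (φ.toPartialEquiv.symm p) = p := φ.right_inv hp
    have hq' : φ.toPartialEquiv (φ.toPartialEquiv.symm q) = q := φ.right_inv hq
    have := φ.map_le_iff _ (φ.map_target hp) _ (φ.map_target hq)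
    change φ.toPartialEquiv (φ.toPartialEquiv.symm p) ≤ φ.toPartialEquiv (φ.toPartialEquiv.symm q)
      ↔ _ at this
    rw [hp', hq'] at this
    exact this.symm

/-- The composition `φ ∘ ψ`, defined on those points of the domain of `ψ` that `ψ` sends to the
domain of `φ`. -/
def mul (φ ψ : Representative G R) : Representative G R where
  toPartialEquiv := ψ.toPartialEquiv.trans φ.toPartialEquiv
  source_cofinite := by
    rw [PartialEquiv.trans_source]
    exact ψ.cofinite_preimage φ.source_cofinite
  target_cofinite := by
    rw [PartialEquiv.trans_target]
    exact φ.inv.cofinite_preimage ψ.target_cofinite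
  map_le_iff p hp q hq := by
    rw [PartialEquiv.trans_source] at hp hq
    exact (φ.map_le_iff _ hp.2 _ hq.2).trans (ψ.map_le_iff _ hp.1 _ hq.1)

theorem one_isHigmanThompson : (one G R).IsHigmanThompson :=
  fun _ _ => ⟨rfl, fun _ _ h => h⟩

theorem IsHigmanThompson.mul {φ ψ : Representative G R} (hφ : φ.IsHigmanThompson)
    (hψ : ψ.IsHigmanThompson) : (φ.mul ψ).IsHigmanThompson := by
  rw [isHigmanThompson_iff] at *
  intro p hp
  have hp' : p ∈ ψ.source ∩ ψ.toPartialEquiv ⁻¹' φ.source := by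
    rw [← PartialEquiv.trans_source]; exact hp
  obtain ⟨h1, h2⟩ := hψ p hp'.1
  obtain ⟨k1, k2⟩ := hφ _ hp'.2
  exact ⟨k1.trans h1, fun w q hq => k2 w _ (h2 w q hq)⟩

theorem IsHigmanThompson.inv {φ : Representative G R} (hφ : φ.IsHigmanThompson) :
    φ.inv.IsHigmanThompson := by
  rw [isHigmanThompson_iff] at *
  intro p hp
  have he : φ.toPartialEquiv (φ.toPartialEquiv.symm p) = p := φ.right_inv hp
  have hm : φ.toPartialEquiv.symm p ∈ φ.source := φ.map_target hp
  obtain ⟨h1, h2⟩ := hφ _ hm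
  rw [he] at h1 h2
  refine ⟨h1.symm, fun w q hq => ?_⟩
  have hw : G.IsWalk R ((φ.toPartialEquiv.symm p).1 ++ w) := by
    rw [isWalk_append]
    refine ⟨(φ.toPartialEquiv.symm p).2, ?_⟩
    have hq2 := q.2
    rw [hq, isWalk_append] at hq2
    unfold UnfoldingTree.terminus at h1
    rw [← h1]
    exact hq2.2
  have h3 := h2 w ⟨_, hw⟩ rfl
  have h4 : φ.toPartialEquiv ⟨_, hw⟩ = q := Subtype.ext (h3.trans hq.symm)
  have h5 : (⟨_, hw⟩ : G.UnfoldingTree R) ∈ φ.source :=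
    φ.source_cofinite.mem_of_le _ hm _ ⟨w, rfl⟩
  have h6 : φ.toPartialEquiv.symm q = ⟨_, hw⟩ := by
    rw [← h4]; exact φ.left_inv h5
  change (φ.toPartialEquiv.symm q).1 = (φ.toPartialEquiv.symm p).1 ++ w
  rw [h6]

end Representative

/-- The almost automorphisms of the unfolding tree: equivalence classes of representatives. -/
def AlmostAut (G : DirectedMultigraph V E) (R : V) : Type v :=
  Quotient (Representative.setoid G R)

namespace AlmostAut

/-- The class of a representative. -/
def mk (φ : Representative G R) : G.AlmostAut R := Quotient.mk _ φ

theorem mk_eq_mk {φ ψ : Representative G R} : mk φ = mk ψ ↔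
    ∃ S, IsCofiniteSubspace S ∧ S ⊆ φ.source ∧ S ⊆ ψ.source ∧
      Set.EqOn φ.toPartialEquiv ψ.toPartialEquiv S :=
  Quotient.eq (r := Representative.setoid G R)

/-- The group operation is induced by composition of representatives. -/
instance : Mul (G.AlmostAut R) where
  mul := Quotient.map₂ Representative.mul (by
    rintro φ φ' ⟨S, hS, h1, h2, h⟩ ψ ψ' ⟨T, hT, k1, k2, k⟩
    have hc := (ψ.cofinite_preimage hS).inter hT
    refine ⟨_, hc, fun x hx => ?_, fun x hx => ?_, fun x hx => ?_⟩
    · change x ∈ (ψ.toPartialEquiv.trans φ.toPartialEquiv).source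
      rw [PartialEquiv.trans_source]
      exact ⟨hx.1.1, h1 hx.1.2⟩
    · change x ∈ (ψ'.toPartialEquiv.trans φ'.toPartialEquiv).source
      rw [PartialEquiv.trans_source]
      refine ⟨k2 hx.2, h2 ?_⟩
      rw [← k hx.2]
      exact hx.1.2
    · change φ.toPartialEquiv (ψ.toPartialEquiv x) = φ'.toPartialEquiv (ψ'.toPartialEquiv x)
      rw [← k hx.2]
      exact h hx.1.2)

instance : One (G.AlmostAut R) := ⟨mk (Representative.one G R)⟩

instance : Inv (G.AlmostAut R) where
  inv := Quotient.map Representative.inv (by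
    rintro φ ψ ⟨S, hS, h1, h2, h⟩
    have hc := (φ.inv.cofinite_preimage hS).inter (ψ.inv.cofinite_preimage hS)
    have key : ∀ x ∈ φ.target, φ.toPartialEquiv.symm x ∈ S →
        ψ.toPartialEquiv.symm x = φ.toPartialEquiv.symm x := fun x hx hxs => by
      have e : ψ.toPartialEquiv (φ.toPartialEquiv.symm x) = x := by
        rw [← h hxs]; exact φ.right_inv hx
      conv_lhs => rw [← e]
      exact ψ.left_inv (h2 hxs)
    exact ⟨_, hc, fun x hx => hx.1.1, fun x hx => hx.2.1,
      fun x hx => (key x hx.1.1 hx.1.2).symm⟩)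

theorem mk_mul (φ ψ : Representative G R) : mk φ * mk ψ = mk (φ.mul ψ) := rfl

theorem mk_inv (φ : Representative G R) : (mk φ)⁻¹ = mk φ.inv := rfl

theorem one_def : (1 : G.AlmostAut R) = mk (Representative.one G R) := rfl

/-- The group of almost automorphisms of the unfolding tree. -/
instance : Group (G.AlmostAut R) :=
  Group.ofLeftAxioms
    (by
      rintro ⟨φ⟩ ⟨ψ⟩ ⟨χ⟩
      refine congrArg mk ?_
      have : ((φ.mul ψ).mul χ).toPartialEquiv = (φ.mul (ψ.mul χ)).toPartialEquiv :=
        (PartialEquiv.trans_assoc _ _ _).symm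
      generalize (φ.mul ψ).mul χ = a at this
      generalize φ.mul (ψ.mul χ) = b at this
      cases a; cases b; cases this; rfl)
    (by
      rintro ⟨φ⟩
      refine mk_eq_mk.2 ⟨φ.source, φ.source_cofinite, ?_, le_rfl, fun _ _ => rfl⟩
      exact fun x hx => ⟨hx, trivial⟩)
    (by
      rintro ⟨φ⟩
      refine mk_eq_mk.2 ⟨φ.source, φ.source_cofinite, ?_, fun _ _ => trivial, ?_⟩
      · exact fun x hx => ⟨hx, φ.map_source hx⟩
      · exact fun x hx => φ.left_inv hx)

end AlmostAut

/-- The Higman–Thompson group of the unfolding tree of `G` based on `R`: the subgroup of all almost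
automorphisms that have a Higman–Thompson representative. -/
def HigmanThompson (G : DirectedMultigraph V E) (R : V) : Subgroup (G.AlmostAut R) where
  carrier := {x | ∃ φ : Representative G R, φ.IsHigmanThompson ∧ AlmostAut.mk φ = x}
  mul_mem' := by
    rintro _ _ ⟨φ, hφ, rfl⟩ ⟨ψ, hψ, rfl⟩
    exact ⟨φ.mul ψ, hφ.mul hψ, rfl⟩
  one_mem' := ⟨_, Representative.one_isHigmanThompson, rfl⟩
  inv_mem' := by
    rintro _ ⟨φ, hφ, rfl⟩
    exact ⟨φ.inv, hφ.inv, rfl⟩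

/-! ### The Leavitt path algebra over the integers -/

/-- The generators of the Leavitt path algebra: the vertices `v`, the edges `e` and the reversed
edges `e*`. -/
inductive LeavittGen (V : Type u) (E : Type v) : Type (max u v)
  | vertex (v : V) : LeavittGen V E
  | edge (e : E) : LeavittGen V E
  | edgeStar (e : E) : LeavittGen V E

/-- The involution on generators: `v* = v`, and `e`, `e*` are exchanged. -/
def LeavittGen.flip : LeavittGen V E → LeavittGen V E
  | vertex v => vertex v
  | edge e => edgeStar e
  | edgeStar e => edge e

/-- The free non-unital (associative) ring on the generators. -/
abbrev FreeLeavitt (V : Type u) (E : Type v) : Type (max u v) :=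
  MonoidAlgebra ℤ (FreeSemigroup (LeavittGen V E))

namespace FreeLeavitt

/-- A generator, as an element of the free ring. -/
noncomputable def gen (x : LeavittGen V E) : FreeLeavitt V E :=
  MonoidAlgebra.single (FreeSemigroup.of x) 1

/-- The antiautomorphism of the free ring that extends `LeavittGen.flip`, as a homomorphism to the
opposite ring. -/
noncomputable def starHom : FreeLeavitt V E →ₙₐ[ℤ] (FreeLeavitt V E)ᵐᵒᵖ :=
  MonoidAlgebra.liftMagma ℤ (FreeSemigroup.lift fun x => MulOpposite.op (gen x.flip))

theorem starHom_gen (x : LeavittGen V E) :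
    starHom (gen x) = MulOpposite.op (gen x.flip) := by
  simp [starHom, gen]

theorem unop_starHom_unop_starHom (x : FreeLeavitt V E) :
    (starHom (starHom x).unop).unop = x := by
  induction x using MonoidAlgebra.induction_linear with
  | zero => simp
  | add a b ha hb => simp [ha, hb]
  | single w n =>
    have hn : (MonoidAlgebra.single w n : FreeLeavitt V E) = n • MonoidAlgebra.single w 1 := by
      simp
    rw [hn, map_zsmul, MulOpposite.unop_smul, map_zsmul, MulOpposite.unop_smul]
    congr 1
    induction w using FreeSemigroup.recOnMul with
    | ih1 g =>
      change (starHom (starHom (gen g)).unop).unop = gen g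
      rw [starHom_gen, MulOpposite.unop_op, starHom_gen, MulOpposite.unop_op]
      cases g <;> rfl
    | ih2 g w hg hw =>
      have hm : (MonoidAlgebra.single (FreeSemigroup.of g * w) 1 : FreeLeavitt V E) =
          MonoidAlgebra.single (FreeSemigroup.of g) 1 * MonoidAlgebra.single w 1 := by
        simp
      rw [hm, map_mul, MulOpposite.unop_mul, map_mul, MulOpposite.unop_mul]
      rw [hg (by simp), hw (by simp)]

/-- The involution of the free ring: it is additive, reverses products, fixes the vertices and
exchanges `e` and `e*`. -/
noncomputable instance : StarRing (FreeLeavitt V E) where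
  star x := (starHom x).unop
  star_involutive := unop_starHom_unop_starHom
  star_mul x y := by simp
  star_add x y := by simp

theorem star_gen (x : LeavittGen V E) : star (gen x) = gen x.flip := by
  change (starHom (gen x)).unop = _
  rw [starHom_gen, MulOpposite.unop_op]

end FreeLeavitt

open FreeLeavitt

open LeavittGen in
/-- The defining relations of the Leavitt path algebra. The last relation
`v = ∑ e e*`, the sum being over all edges `e` with origin `v`, is imposed at every vertex `v`
that is the origin of at least one and of only finitely many edges. -/
inductive LeavittRel (G : DirectedMultigraph V E) : FreeLeavitt V E → FreeLeavitt V E → Prop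
  | vertex_mul_self (v : V) : LeavittRel G (gen (vertex v) * gen (vertex v)) (gen (vertex v))
  | vertex_mul_of_ne (v w : V) (h : v ≠ w) : LeavittRel G (gen (vertex v) * gen (vertex w)) 0
  | origin_mul_edge (e : E) : LeavittRel G (gen (vertex (G.o e)) * gen (edge e)) (gen (edge e))
  | edge_mul_terminus (e : E) : LeavittRel G (gen (edge e) * gen (vertex (G.t e))) (gen (edge e))
  | terminus_mul_edgeStar (e : E) :
      LeavittRel G (gen (vertex (G.t e)) * gen (edgeStar e)) (gen (edgeStar e))
  | edgeStar_mul_origin (e : E) :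
      LeavittRel G (gen (edgeStar e) * gen (vertex (G.o e))) (gen (edgeStar e))
  | edgeStar_mul_edge_self (e : E) :
      LeavittRel G (gen (edgeStar e) * gen (edge e)) (gen (vertex (G.t e)))
  | edgeStar_mul_edge_of_ne (e f : E) (h : e ≠ f) :
      LeavittRel G (gen (edgeStar e) * gen (edge f)) 0
  | vertex_eq_sum (v : V) (s : Finset E) (hs : ∀ e, e ∈ s ↔ G.o e = v) (hne : s.Nonempty) :
      LeavittRel G (gen (vertex v)) (∑ e ∈ s, gen (edge e) * gen (edgeStar e))

theorem LeavittRel.star_rel {G : DirectedMultigraph V E} (a b : FreeLeavitt V E)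
    (h : LeavittRel G a b) : LeavittRel G (star a) (star b) := by
  cases h with
  | vertex_mul_self v => simpa [star_gen, LeavittGen.flip] using .vertex_mul_self v
  | vertex_mul_of_ne v w h =>
    simpa [star_gen, LeavittGen.flip] using .vertex_mul_of_ne w v h.symm
  | origin_mul_edge e => simpa [star_gen, LeavittGen.flip] using .edgeStar_mul_origin e
  | edge_mul_terminus e => simpa [star_gen, LeavittGen.flip] using .terminus_mul_edgeStar e
  | terminus_mul_edgeStar e => simpa [star_gen, LeavittGen.flip] using .edge_mul_terminus e
  | edgeStar_mul_origin e => simpa [star_gen, LeavittGen.flip] using .origin_mul_edge e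
  | edgeStar_mul_edge_self e =>
    simpa [star_gen, LeavittGen.flip] using .edgeStar_mul_edge_self e
  | edgeStar_mul_edge_of_ne e f h =>
    simpa [star_gen, LeavittGen.flip] using .edgeStar_mul_edge_of_ne f e h.symm
  | vertex_eq_sum v s hs hne =>
    simpa [star_gen, LeavittGen.flip] using .vertex_eq_sum v s hs hne

/-- The Leavitt path algebra `L_ℤ(G)`: the non-unital ring given by the generators and relations
above. -/
def LeavittPathAlgebra (G : DirectedMultigraph V E) : Type (max u v) :=
  (ringConGen G.LeavittRel).Quotient

namespace LeavittPathAlgebra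

noncomputable instance (G : DirectedMultigraph V E) : NonUnitalRing G.LeavittPathAlgebra :=
  inferInstanceAs (NonUnitalRing (ringConGen G.LeavittRel).Quotient)

/-- The canonical map from the free ring. -/
noncomputable def ofFree (G : DirectedMultigraph V E) :
    FreeLeavitt V E →ₙ+* G.LeavittPathAlgebra where
  toFun x := RingCon.toQuotient (c := ringConGen G.LeavittRel) x
  map_mul' _ _ := rfl
  map_zero' := rfl
  map_add' _ _ := rfl

theorem ofFree_surjective (G : DirectedMultigraph V E) : Function.Surjective (ofFree G) :=
  fun x => Quotient.inductionOn' x fun y => ⟨y, rfl⟩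

theorem ofFree_eq_iff {x y : FreeLeavitt V E} :
    ofFree G x = ofFree G y ↔ ringConGen G.LeavittRel x y :=
  RingCon.eq _

theorem ofFree_eq_of_rel {x y : FreeLeavitt V E} (h : G.LeavittRel x y) :
    ofFree G x = ofFree G y :=
  ofFree_eq_iff.2 (RingConGen.Rel.of _ _ h)

/-- The involution of the Leavitt path algebra, induced by the one of the free ring. -/
noncomputable instance : Star G.LeavittPathAlgebra where
  star := Quotient.map' star (fun _ _ h => ringConGen_star LeavittRel.star_rel h)

theorem star_ofFree (x : FreeLeavitt V E) : star (ofFree G x) = ofFree G (star x) := rfl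

noncomputable instance : StarRing G.LeavittPathAlgebra where
  star_involutive x := by
    obtain ⟨x, rfl⟩ := ofFree_surjective G x
    rw [star_ofFree, star_ofFree, star_star]
  star_mul x y := by
    obtain ⟨x, rfl⟩ := ofFree_surjective G x
    obtain ⟨y, rfl⟩ := ofFree_surjective G y
    rw [← map_mul, star_ofFree, star_mul, map_mul, star_ofFree, star_ofFree]
  star_add x y := by
    obtain ⟨x, rfl⟩ := ofFree_surjective G x
    obtain ⟨y, rfl⟩ := ofFree_surjective G y
    rw [← map_add, star_ofFree, star_add, map_add, star_ofFree, star_ofFree]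

/-- A vertex, as an element of the Leavitt path algebra. -/
noncomputable def vertex (G : DirectedMultigraph V E) (v : V) : G.LeavittPathAlgebra :=
  ofFree G (gen (.vertex v))

/-- An edge, as an element of the Leavitt path algebra. -/
noncomputable def edge (G : DirectedMultigraph V E) (e : E) : G.LeavittPathAlgebra :=
  ofFree G (gen (.edge e))

/-- The walk `l` originating in `v`, as an element of the Leavitt path algebra: the vertex `v` if
`l` is empty, and otherwise the product of the edges of `l` (the product
`e₁ ⋯ eₙ t(eₙ)` is the same as `e₁ ⋯ eₙ`). -/
noncomputable def walk (G : DirectedMultigraph V E) : V → List E → G.LeavittPathAlgebra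
  | v, [] => vertex G v
  | _, e :: l => edge G e * walk G (G.t e) l

theorem vertex_mul_self (v : V) : vertex G v * vertex G v = vertex G v :=
  ofFree_eq_of_rel (.vertex_mul_self v)

theorem star_vertex (v : V) : star (vertex G v) = vertex G v := by
  rw [vertex, star_ofFree, star_gen]; rfl

theorem origin_mul_edge (e : E) : vertex G (G.o e) * edge G e = edge G e :=
  ofFree_eq_of_rel (.origin_mul_edge e)

theorem star_edge_mul_edge_self (e : E) : star (edge G e) * edge G e = vertex G (G.t e) := by
  rw [edge, star_ofFree, star_gen]
  exact ofFree_eq_of_rel (.edgeStar_mul_edge_self e)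

theorem star_edge_mul_edge_of_ne {e f : E} (h : e ≠ f) : star (edge G e) * edge G f = 0 := by
  rw [edge, star_ofFree, star_gen]
  exact (ofFree_eq_of_rel (.edgeStar_mul_edge_of_ne e f h)).trans (map_zero _)

theorem vertex_mul_walk {v : V} {l : List E} (h : G.IsWalk v l) :
    vertex G v * walk G v l = walk G v l := by
  cases l with
  | nil => exact vertex_mul_self v
  | cons e l =>
    obtain ⟨rfl, -⟩ := h
    rw [walk, ← mul_assoc, origin_mul_edge]

theorem walk_append {v : V} {l m : List E} (h : G.IsWalk v (l ++ m)) :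
    walk G v (l ++ m) = walk G v l * walk G (G.terminus v l) m := by
  induction l generalizing v with
  | nil => exact (vertex_mul_walk h).symm
  | cons e l ih =>
    change edge G e * walk G (G.t e) (l ++ m) = edge G e * walk G (G.t e) l * _
    rw [ih h.2, mul_assoc]
    rfl

theorem star_walk_mul_walk {v : V} {l m : List E} (hl : G.IsWalk v l) (hm : G.IsWalk v m) :
    (∃ r, m = l ++ r ∧ star (walk G v l) * walk G v m = walk G (G.terminus v l) r) ∨
    (∃ r, l = m ++ r ∧ star (walk G v l) * walk G v m = star (walk G (G.terminus v m) r)) ∨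
    star (walk G v l) * walk G v m = 0 := by
  induction l generalizing v m with
  | nil =>
    refine Or.inl ⟨m, rfl, ?_⟩
    change star (vertex G v) * walk G v m = walk G v m
    rw [star_vertex, vertex_mul_walk hm]
  | cons e l ih =>
    cases m with
    | nil =>
      refine Or.inr (Or.inl ⟨e :: l, rfl, ?_⟩)
      change star (walk G v (e :: l)) * vertex G v = star (walk G v (e :: l))
      rw [← star_vertex, ← star_mul, vertex_mul_walk hl]
    | cons f m =>
      by_cases hef : e = f
      · subst hef
        have key : star (walk G v (e :: l)) * walk G v (e :: m) =
            star (walk G (G.t e) l) * walk G (G.t e) m := by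
          rw [walk, walk, star_mul, mul_assoc, ← mul_assoc (star (edge G e)),
            star_edge_mul_edge_self, vertex_mul_walk hm.2]
        rw [key]
        rcases ih hl.2 hm.2 with ⟨r, h1, h2⟩ | ⟨r, h1, h2⟩ | h
        · exact Or.inl ⟨r, by rw [h1, List.cons_append], h2⟩
        · exact Or.inr (Or.inl ⟨r, by rw [h1, List.cons_append], h2⟩)
        · exact Or.inr (Or.inr h)
      · refine Or.inr (Or.inr ?_)
        rw [walk, walk, star_mul, mul_assoc, ← mul_assoc (star (edge G e)),
          star_edge_mul_edge_of_ne hef, zero_mul, mul_zero]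

/-- The elements `p q*`, where `p` and `q` are walks originating in `R` with the same terminal
vertex. -/
def rootedGenerators (G : DirectedMultigraph V E) (R : V) : Set G.LeavittPathAlgebra :=
  {x | ∃ p q : G.UnfoldingTree R, p.terminus = q.terminus ∧
    x = walk G R p.1 * star (walk G R q.1)}

theorem star_mem_rootedGenerators {x : G.LeavittPathAlgebra} (hx : x ∈ rootedGenerators G R) :
    star x ∈ rootedGenerators G R := by
  obtain ⟨p, q, h, rfl⟩ := hx
  exact ⟨q, p, h.symm, by rw [star_mul, star_star]⟩

theorem mul_mem_rootedGenerators {x y : G.LeavittPathAlgebra} (hx : x ∈ rootedGenerators G R)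
    (hy : y ∈ rootedGenerators G R) : x * y ∈ rootedGenerators G R ∨ x * y = 0 := by
  obtain ⟨p, q, h, rfl⟩ := hx
  obtain ⟨p', q', h', rfl⟩ := hy
  unfold UnfoldingTree.terminus at h h'
  have hr : walk G R p.1 * star (walk G R q.1) * (walk G R p'.1 * star (walk G R q'.1)) =
      walk G R p.1 * (star (walk G R q.1) * walk G R p'.1) * star (walk G R q'.1) := by
    simp only [mul_assoc]
  rw [hr]
  rcases star_walk_mul_walk q.2 p'.2 with ⟨r, h1, h2⟩ | ⟨r, h1, h2⟩ | h0
  · have hw : G.IsWalk R (p.1 ++ r) := by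
      have := p'.2
      rw [h1, isWalk_append, ← h] at this
      exact (isWalk_append _ _ _ _).2 ⟨p.2, this.2⟩
    refine Or.inl ⟨⟨_, hw⟩, q', ?_, ?_⟩
    · change G.terminus R (p.1 ++ r) = G.terminus R q'.1
      rw [terminus_append, h, ← terminus_append, ← h1, h']
    · rw [h2, walk_append hw, h]
  · have hw : G.IsWalk R (q'.1 ++ r) := by
      have := q.2
      rw [h1, isWalk_append, h'] at this
      exact (isWalk_append _ _ _ _).2 ⟨q'.2, this.2⟩
    refine Or.inl ⟨p, ⟨_, hw⟩, ?_, ?_⟩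
    · change G.terminus R p.1 = G.terminus R (q'.1 ++ r)
      rw [terminus_append, ← h', ← terminus_append, ← h1, h]
    · rw [h2, walk_append hw, h', star_mul, mul_assoc]
  · right
    rw [h0, mul_zero, zero_mul]

/-- The rooted Leavitt path algebra `L_ℤ(G, R)`: the `*`-subalgebra of `L_ℤ(G)` whose underlying
`ℤ`-module is spanned by the elements `p q*`, where `p` and `q` are walks originating in `R` with the
same terminal vertex. -/
noncomputable def rooted (G : DirectedMultigraph V E) (R : V) :
    NonUnitalStarSubalgebra ℤ G.LeavittPathAlgebra where
  toSubmodule := Submodule.span ℤ (rootedGenerators G R)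
  mul_mem' {a b} ha hb := by
    change a ∈ Submodule.span ℤ (rootedGenerators G R) at ha
    change b ∈ Submodule.span ℤ (rootedGenerators G R) at hb
    change a * b ∈ Submodule.span ℤ (rootedGenerators G R)
    induction ha using Submodule.span_induction with
    | zero => simp
    | add x y _ _ hx hy => rw [add_mul]; exact add_mem hx hy
    | smul n x _ hx => rw [smul_mul_assoc]; exact Submodule.smul_mem _ n hx
    | mem x hx =>
      induction hb using Submodule.span_induction with
      | zero => simp
      | add y z _ _ hy hz => rw [mul_add]; exact add_mem hy hz
      | smul n y _ hy => rw [mul_smul_comm]; exact Submodule.smul_mem _ n hy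
      | mem y hy =>
        rcases mul_mem_rootedGenerators hx hy with h | h
        · exact Submodule.subset_span h
        · rw [h]; exact zero_mem _
  star_mem' {a} ha := by
    change a ∈ Submodule.span ℤ (rootedGenerators G R) at ha
    change star a ∈ Submodule.span ℤ (rootedGenerators G R)
    induction ha using Submodule.span_induction with
    | zero => simp
    | add x y _ _ hx hy => rw [star_add]; exact add_mem hx hy
    | smul n x _ hx => rw [star_zsmul]; exact Submodule.smul_mem _ n hx
    | mem x hx => exact Submodule.subset_span (star_mem_rootedGenerators hx)

end LeavittPathAlgebra

end DirectedMultigraph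

/-!
The Higman–Thompson group is recovered from the unital star ring `A = L_ℤ(G, R)` alone: it is the
group of unitaries of `A` modulo the normal subgroup of the unitaries congruent to `1` modulo `2`
(`higmanThompsonEquiv`). A star ring isomorphism preserves both groups, so the theorem follows.

A Higman–Thompson representative `φ` yields the unitary `∑ φ(b) b*`, summed over the basis of its
domain. It is determined by the property that left multiplication by it sends `q` to `φ(q)` for all
walks `q` in some cofinite subspace (`Implements`), because an element of `A` that annihilates all
these walks is zero (`mul_vertex_eq_zero`). This makes the assignment a well-defined homomorphism
`toUnitary`.

Conversely, let `u` be a unitary. For all `q` in some cofinite subspace, `u q` is an integer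
combination `∑ c_p p` of walks with the same terminus `v` as `q`, and `(u q)* (u q) = v`. In the
graded boundary path representation, the diagonal coefficient of `p* p'` at a boundary path
that starts at `v` is `1` if `p = p'`, and `0` otherwise. Hence `∑ c_p ^ 2 = 1`, and as the
coefficients are integers, `u q` is a walk `f(q)` up to sign (`exists_eq_smul_treeWalk`). The map `f`
is a Higman–Thompson representative (`exists_representative_sendsWalk`), whose unitary is congruent
to `u` modulo `2`, since signs disappear there. This gives surjectivity. Injectivity holds because
distinct walks with the same terminus remain distinct modulo `2`, again by the diagonal coefficients.
-/

namespace DirectedMultigraph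

universe u v

variable {V : Type u} {E : Type v} {G : DirectedMultigraph V E} {R : V}

open UnfoldingTree FreeLeavitt

/-! ### Boundary paths -/

/-- The vertex at which a letter of a boundary path starts: a letter is either an edge or a
vertex. -/
def letterOrigin (G : DirectedMultigraph V E) : V ⊕ E → V := Sum.elim id G.o

/-- The letter `b` may follow the letter `a` in a boundary path: an edge is followed by a letter
starting at its terminus, and a vertex letter is allowed only at a sink, where it repeats. -/
def BoundaryStep (G : DirectedMultigraph V E) : V ⊕ E → V ⊕ E → Prop
  | .inl v, b => (∀ e, G.o e ≠ v) ∧ b = .inl v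
  | .inr e, b => G.letterOrigin b = G.t e

/-- A boundary path of `G` is an infinite walk or a finite walk that ends in a sink. A finite one is
encoded as a sequence by repeating its final sink forever. -/
def BoundaryPath (G : DirectedMultigraph V E) : Type (max u v) :=
  {ξ : ℕ → V ⊕ E // ∀ n, G.BoundaryStep (ξ n) (ξ (n + 1))}

namespace BoundaryPath

/-- The vertex at which a boundary path starts. -/
def origin (ξ : G.BoundaryPath) : V := G.letterOrigin (ξ.1 0)

/-- The boundary path `e ξ`. -/
def cons (e : E) (ξ : G.BoundaryPath) (h : ξ.origin = G.t e) : G.BoundaryPath :=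
  ⟨fun n => Nat.casesOn n (.inr e) ξ.1, fun n => by
    cases n with
    | zero => exact h
    | succ n => exact ξ.2 n⟩

/-- The boundary path without its first letter. -/
def tail (ξ : G.BoundaryPath) : G.BoundaryPath := ⟨fun n => ξ.1 (n + 1), fun n => ξ.2 (n + 1)⟩

theorem origin_cons (e : E) (ξ : G.BoundaryPath) (h : ξ.origin = G.t e) :
    (cons e ξ h).origin = G.o e := rfl

theorem cons_zero (e : E) (ξ : G.BoundaryPath) (h : ξ.origin = G.t e) :
    (cons e ξ h).1 0 = .inr e := rfl

theorem tail_cons (e : E) (ξ : G.BoundaryPath) (h : ξ.origin = G.t e) :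
    (cons e ξ h).tail = ξ := rfl

theorem origin_of_zero_eq {ξ : G.BoundaryPath} {e : E} (h : ξ.1 0 = .inr e) :
    ξ.origin = G.o e := by
  rw [origin, h]; rfl

theorem origin_tail {ξ : G.BoundaryPath} {e : E} (h : ξ.1 0 = .inr e) :
    ξ.tail.origin = G.t e := by
  have := ξ.2 0
  rw [h] at this
  exact this

theorem cons_tail {ξ : G.BoundaryPath} {e : E} (h : ξ.1 0 = .inr e) :
    cons e ξ.tail (origin_tail h) = ξ := by
  refine Subtype.ext (funext fun n => ?_)
  cases n with
  | zero => exact h.symm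
  | succ n => rfl

theorem exists_zero_eq {ξ : G.BoundaryPath} {e : E} (h : ξ.origin = G.o e) :
    ∃ f, ξ.1 0 = .inr f := by
  have := ξ.2 0
  cases h0 : ξ.1 0 with
  | inl v =>
    rw [h0] at this
    rw [origin, h0] at h
    exact absurd h.symm (this.1 e)
  | inr f => exact ⟨f, rfl⟩

theorem exists_origin_eq (G : DirectedMultigraph V E) (v : V) :
    ∃ ξ : G.BoundaryPath, ξ.origin = v := by
  -- Each vertex gets a letter starting there: an edge unless the vertex is a sink. The path follows
  -- these letters from `v` on.
  have hletter : ∀ w : V, ∃ a : V ⊕ E, G.letterOrigin a = w ∧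
      ∀ x, a = .inl x → ∀ e, G.o e ≠ x := fun w => by
    by_cases h : ∃ e, G.o e = w
    · obtain ⟨e, he⟩ := h
      exact ⟨.inr e, he, by simp⟩
    · push Not at h
      exact ⟨.inl w, rfl, fun x hx => by cases hx; exact h⟩
  choose a ha hsink using hletter
  let next : V ⊕ E → V ⊕ E := Sum.elim .inl fun e => a (G.t e)
  let s : ℕ → V ⊕ E := fun n => next^[n] (a v)
  have hs : ∀ n, s (n + 1) = next (s n) := fun n => Function.iterate_succ_apply' next n (a v)
  have hs' : ∀ n x, s n = .inl x → ∀ e, G.o e ≠ x := fun n => by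
    induction n with
    | zero => exact hsink v
    | succ n ih =>
      rw [hs]
      cases h : s n with
      | inl y => rintro x ⟨⟩; exact ih y h
      | inr e => exact hsink (G.t e)
  refine ⟨⟨s, fun n => ?_⟩, ha v⟩
  rw [hs]
  cases h : s n with
  | inl x => exact ⟨hs' n x h, rfl⟩
  | inr e => exact ha (G.t e)

end BoundaryPath

/-! ### The graded boundary path representation -/

namespace LeavittPathAlgebra

open BoundaryPath

/-- The module of the graded boundary path representation: it is free on the pairs of a
boundary path and a degree. -/
abbrev BoundaryModule (G : DirectedMultigraph V E) : Type (max u v) :=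
  (G.BoundaryPath × ℤ) →₀ ℤ

open Classical in
/-- The image of a basis vector under a generator: an edge is prepended and raises the degree by
one, a reversed edge is removed and lowers it. -/
noncomputable def genBasis (G : DirectedMultigraph V E) :
    LeavittGen V E → G.BoundaryPath × ℤ → BoundaryModule G
  | .vertex v, i => if i.1.origin = v then .single i 1 else 0
  | .edge e, i => if h : i.1.origin = G.t e then .single (cons e i.1 h, i.2 + 1) 1 else 0
  | .edgeStar e, i => if i.1.1 0 = .inr e then .single (i.1.tail, i.2 - 1) 1 else 0

/-- The action of a generator on the boundary path module. -/
noncomputable def genEnd (G : DirectedMultigraph V E) (g : LeavittGen V E) :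
    Module.End ℤ (BoundaryModule G) :=
  Finsupp.linearCombination ℤ (genBasis G g)

theorem genEnd_single (g : LeavittGen V E) (i : G.BoundaryPath × ℤ) :
    genEnd G g (.single i 1) = genBasis G g i := by
  simp [genEnd]

/-- The action of the free ring on the boundary path module. -/
noncomputable def freeRep (G : DirectedMultigraph V E) :
    FreeLeavitt V E →ₙₐ[ℤ] Module.End ℤ (BoundaryModule G) :=
  MonoidAlgebra.liftMagma ℤ (FreeSemigroup.lift (genEnd G))

theorem freeRep_gen (g : LeavittGen V E) : freeRep G (gen g) = genEnd G g := by
  simp [freeRep, gen]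

theorem boundaryEnd_ext {f g : Module.End ℤ (BoundaryModule G)}
    (h : ∀ (ξ : G.BoundaryPath) (n : ℤ), f (.single (ξ, n) 1) = g (.single (ξ, n) 1)) : f = g := by
  refine Finsupp.lhom_ext' fun i => LinearMap.ext_ring ?_
  exact h i.1 i.2

theorem freeRep_eq_of_rel {x y : FreeLeavitt V E} (h : G.LeavittRel x y) :
    freeRep G x = freeRep G y := by
  classical
  refine boundaryEnd_ext fun ξ n => ?_
  cases h with
  | vertex_mul_self v =>
    simp only [map_mul, freeRep_gen, Module.End.mul_apply, genEnd_single, genBasis]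
    split_ifs with h <;> simp [genEnd_single, genBasis, h]
  | vertex_mul_of_ne v w hvw =>
    simp only [map_mul, freeRep_gen, Module.End.mul_apply, genEnd_single, genBasis, map_zero]
    split_ifs with h
    · simp [genEnd_single, genBasis, h, hvw.symm]
    · simp
  | origin_mul_edge e =>
    simp only [map_mul, freeRep_gen, Module.End.mul_apply, genEnd_single, genBasis]
    split_ifs with h <;> simp [genEnd_single, genBasis, origin_cons]
  | edge_mul_terminus e =>
    simp only [map_mul, freeRep_gen, Module.End.mul_apply, genEnd_single, genBasis]
    split_ifs with h <;> simp [genEnd_single, genBasis, h]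
  | terminus_mul_edgeStar e =>
    simp only [map_mul, freeRep_gen, Module.End.mul_apply, genEnd_single, genBasis]
    split_ifs with h
    · simp [genEnd_single, genBasis, origin_tail h]
    · simp
  | edgeStar_mul_origin e =>
    simp only [map_mul, freeRep_gen, Module.End.mul_apply, genEnd_single, genBasis]
    split_ifs with h h' h'
    · simp [genEnd_single, genBasis, h']
    · simp [genEnd_single, genBasis, h']
    · exact absurd (origin_of_zero_eq h') h
    · simp
  | edgeStar_mul_edge_self e =>
    simp only [map_mul, freeRep_gen, Module.End.mul_apply, genEnd_single, genBasis]
    split_ifs with h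
    · simp [genEnd_single, genBasis, cons_zero, tail_cons]
    · simp
  | edgeStar_mul_edge_of_ne e f hef =>
    simp only [map_mul, freeRep_gen, Module.End.mul_apply, genEnd_single, genBasis, map_zero]
    split_ifs with h
    · simp [genEnd_single, genBasis, cons_zero, hef.symm]
    · simp
  | vertex_eq_sum v s hs hne =>
    simp only [map_mul, map_sum, freeRep_gen, Module.End.mul_apply, LinearMap.sum_apply,
      genEnd_single, genBasis]
    have hterm : ∀ e, genEnd G (.edge e)
        (if ξ.1 0 = .inr e then .single (ξ.tail, n - 1) 1 else 0) =
        if ξ.1 0 = .inr e then .single (ξ, n) 1 else 0 := fun e => by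
      split_ifs with h
      · simp [genEnd_single, genBasis, origin_tail h, cons_tail h]
      · simp
    simp only [hterm]
    split_ifs with h
    · obtain ⟨e, he⟩ := hne
      obtain ⟨f, hf⟩ := exists_zero_eq (h.trans ((hs e).1 he).symm)
      rw [Finset.sum_eq_single f]
      · simp [hf]
      · intro e' _ hne'
        simp [hf, hne'.symm]
      · intro hfs
        exact absurd ((hs f).2 ((origin_of_zero_eq hf).symm.trans h)) hfs
    · refine (Finset.sum_eq_zero fun e he => if_neg fun h0 => h ?_).symm
      rw [origin_of_zero_eq h0, (hs e).1 he]

theorem freeRep_eq_of_ringConGen {x y : FreeLeavitt V E} (h : ringConGen G.LeavittRel x y) :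
    freeRep G x = freeRep G y := by
  induction h with
  | of x y h => exact freeRep_eq_of_rel h
  | refl x => rfl
  | symm _ h => exact h.symm
  | trans _ _ h k => exact h.trans k
  | add _ _ h k => rw [map_add, map_add, h, k]
  | mul _ _ h k => rw [map_mul, map_mul, h, k]

/-- The graded boundary path representation of the Leavitt path algebra. -/
noncomputable def boundaryRep (G : DirectedMultigraph V E) :
    G.LeavittPathAlgebra →ₙ+* Module.End ℤ (BoundaryModule G) where
  toFun := Quotient.lift (freeRep G) fun _ _ h => freeRep_eq_of_ringConGen h
  map_mul' x y := by
    obtain ⟨x, rfl⟩ := ofFree_surjective G x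
    obtain ⟨y, rfl⟩ := ofFree_surjective G y
    exact map_mul (freeRep G) x y
  map_zero' := map_zero (freeRep G)
  map_add' x y := by
    obtain ⟨x, rfl⟩ := ofFree_surjective G x
    obtain ⟨y, rfl⟩ := ofFree_surjective G y
    exact map_add (freeRep G) x y

theorem boundaryRep_gen (g : LeavittGen V E) :
    boundaryRep G (ofFree G (gen g)) = genEnd G g := freeRep_gen g

/-- An endomorphism of the boundary path module is homogeneous of degree `d` if it raises degrees
by `d`. -/
def IsHomogeneousEnd (d : ℤ) (f : Module.End ℤ (BoundaryModule G)) : Prop :=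
  ∀ n : ℤ, Finsupp.supported ℤ ℤ {i : G.BoundaryPath × ℤ | i.2 = n} ≤
    (Finsupp.supported ℤ ℤ {i : G.BoundaryPath × ℤ | i.2 = n + d}).comap f

theorem IsHomogeneousEnd.mul {c d : ℤ} {f g : Module.End ℤ (BoundaryModule G)}
    (hf : IsHomogeneousEnd c f) (hg : IsHomogeneousEnd d g) : IsHomogeneousEnd (d + c) (f * g) :=
  fun n x hx => by
    have := hf _ (hg n hx)
    rwa [add_assoc] at this

theorem isHomogeneousEnd_genEnd {d : ℤ} {g : LeavittGen V E}
    (h : ∀ i : G.BoundaryPath × ℤ,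
      genBasis G g i ∈ Finsupp.supported ℤ ℤ {j : G.BoundaryPath × ℤ | j.2 = i.2 + d}) :
    IsHomogeneousEnd d (genEnd G g) := fun n => by
  rw [Finsupp.supported_eq_span_single, Submodule.span_le]
  rintro _ ⟨i, hi, rfl⟩
  change genEnd G g (.single i 1) ∈ Finsupp.supported ℤ ℤ _
  rw [genEnd_single]
  obtain rfl : i.2 = n := hi
  exact h i

theorem isHomogeneousEnd_vertex (v : V) : IsHomogeneousEnd 0 (boundaryRep G (vertex G v)) := by
  rw [vertex, boundaryRep_gen]
  refine isHomogeneousEnd_genEnd fun i => ?_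
  simp only [genBasis]
  split_ifs
  · exact Finsupp.single_mem_supported ℤ _ (by simp)
  · exact zero_mem _

theorem isHomogeneousEnd_edge (e : E) : IsHomogeneousEnd 1 (boundaryRep G (edge G e)) := by
  rw [edge, boundaryRep_gen]
  refine isHomogeneousEnd_genEnd fun i => ?_
  simp only [genBasis]
  split_ifs
  · exact Finsupp.single_mem_supported ℤ _ (by simp)
  · exact zero_mem _

theorem isHomogeneousEnd_star_edge (e : E) :
    IsHomogeneousEnd (-1) (boundaryRep G (star (edge G e))) := by
  rw [edge, star_ofFree, star_gen, LeavittGen.flip, boundaryRep_gen]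
  refine isHomogeneousEnd_genEnd fun i => ?_
  simp only [genBasis]
  split_ifs
  · exact Finsupp.single_mem_supported ℤ _ (by simp [sub_eq_add_neg])
  · exact zero_mem _

theorem isHomogeneousEnd_walk (v : V) (l : List E) :
    IsHomogeneousEnd l.length (boundaryRep G (walk G v l)) := by
  induction l generalizing v with
  | nil => exact isHomogeneousEnd_vertex v
  | cons e l ih =>
    rw [walk, map_mul, List.length_cons, Nat.cast_succ]
    exact (isHomogeneousEnd_edge e).mul (ih _)

theorem isHomogeneousEnd_star_walk (v : V) (l : List E) :
    IsHomogeneousEnd (-l.length) (boundaryRep G (star (walk G v l))) := by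
  induction l generalizing v with
  | nil =>
    rw [walk, star_vertex]
    exact isHomogeneousEnd_vertex v
  | cons e l ih =>
    rw [walk, star_mul, map_mul, List.length_cons, Nat.cast_succ, neg_add_rev]
    exact (ih _).mul (isHomogeneousEnd_star_edge e)

/-- The diagonal coefficient of the boundary path representation at a boundary path in degree
zero. -/
noncomputable def diagCoeff (ξ : G.BoundaryPath) : G.LeavittPathAlgebra →+ ℤ where
  toFun x := boundaryRep G x (.single (ξ, 0) 1) (ξ, 0)
  map_zero' := by simp
  map_add' x y := by simp

theorem diagCoeff_vertex (ξ : G.BoundaryPath) : diagCoeff ξ (vertex G ξ.origin) = 1 := by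
  change boundaryRep G _ _ _ = _
  rw [vertex, boundaryRep_gen, genEnd_single]
  simp [genBasis]

theorem diagCoeff_eq_zero {ξ : G.BoundaryPath} {x : G.LeavittPathAlgebra} {d : ℤ}
    (hx : IsHomogeneousEnd d (boundaryRep G x)) (hd : d ≠ 0) : diagCoeff ξ x = 0 := by
  have h := hx 0 (Finsupp.single_mem_supported ℤ (1 : ℤ)
    (show (ξ, (0 : ℤ)) ∈ {i : G.BoundaryPath × ℤ | i.2 = 0} from rfl))
  refine Finsupp.notMem_support_iff.1 fun hmem => hd ?_
  have := (Finsupp.mem_supported ℤ _).1 h hmem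
  simpa using this.symm

theorem star_walk_mul_walk_append {v : V} {l r : List E} (h : G.IsWalk v (l ++ r)) :
    star (walk G v l) * walk G v (l ++ r) = walk G (G.terminus v l) r := by
  induction l generalizing v with
  | nil =>
    change star (vertex G v) * walk G v r = walk G v r
    rw [star_vertex]
    exact vertex_mul_walk h
  | cons e l ih =>
    have h' : G.IsWalk (G.t e) (l ++ r) := h.2
    rw [List.cons_append, walk, walk, star_mul, mul_assoc, ← mul_assoc (star (edge G e)),
      star_edge_mul_edge_self, vertex_mul_walk h', ih h']
    rfl

theorem star_walk_mul_self (p : G.UnfoldingTree R) :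
    star (walk G R p.1) * walk G R p.1 = vertex G p.terminus := by
  have h := star_walk_mul_walk_append (G := G) (v := R) (l := p.1) (r := [])
    (by rw [List.append_nil]; exact p.2)
  rwa [List.append_nil] at h

theorem diagCoeff_star_walk_mul_self {ξ : G.BoundaryPath} {p : G.UnfoldingTree R}
    (hp : p.terminus = ξ.origin) :
    diagCoeff ξ (star (walk G R p.1) * walk G R p.1) = 1 := by
  rw [star_walk_mul_self, hp, diagCoeff_vertex]

/-- Distinct walks are orthogonal for the diagonal coefficient: either their ranges are orthogonal,
or they differ in degree. -/
theorem diagCoeff_star_walk_mul_walk_of_ne (ξ : G.BoundaryPath) {p q : G.UnfoldingTree R}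
    (hpq : p ≠ q) : diagCoeff ξ (star (walk G R p.1) * walk G R q.1) = 0 := by
  have hlen : ∀ r : List E, r ≠ [] → (r.length : ℤ) ≠ 0 := fun r hr => by simpa using hr
  have hne : p.1 ≠ q.1 := fun h => hpq (Subtype.ext h)
  rcases star_walk_mul_walk p.2 q.2 with ⟨r, h1, h2⟩ | ⟨r, h1, h2⟩ | h
  · rw [h2]
    refine diagCoeff_eq_zero (isHomogeneousEnd_walk _ _) (hlen r ?_)
    rintro rfl
    exact hne (by rw [h1, List.append_nil])
  · rw [h2]
    refine diagCoeff_eq_zero (isHomogeneousEnd_star_walk _ _) (neg_ne_zero.2 (hlen r ?_))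
    rintro rfl
    exact hne (by rw [h1, List.append_nil])
  · rw [h, map_zero]

end LeavittPathAlgebra

/-! ### Finiteness of bases in the unfolding tree -/

namespace UnfoldingTree

/-- The empty walk, as the root of the unfolding tree. -/
def root (G : DirectedMultigraph V E) (R : V) : G.UnfoldingTree R := ⟨[], trivial⟩

/-- The extension of the walk `p` by the walk `w`. -/
def extend (p : G.UnfoldingTree R) (w : List E) (h : G.IsWalk p.terminus w) : G.UnfoldingTree R :=
  ⟨p.1 ++ w, (isWalk_append G R p.1 w).2 ⟨p.2, h⟩⟩

theorem le_extend (p : G.UnfoldingTree R) {w : List E} (h : G.IsWalk p.terminus w) :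
    p ≤ p.extend w h := ⟨w, rfl⟩

theorem terminus_extend (p : G.UnfoldingTree R) {w : List E} (h : G.IsWalk p.terminus w) :
    (p.extend w h).terminus = G.terminus p.terminus w :=
  terminus_append G R p.1 w

theorem exists_extend_eq {p q : G.UnfoldingTree R} (h : p ≤ q) :
    ∃ w hw, q = p.extend w hw := by
  obtain ⟨w, hw⟩ := h
  have := q.2
  rw [← hw, isWalk_append] at this
  exact ⟨w, this.2, Subtype.ext hw.symm⟩

theorem eq_of_mem_basis_of_le {S : Set (G.UnfoldingTree R)} {b c : G.UnfoldingTree R}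
    (hb : b ∈ basis S) (hc : c ∈ basis S) (h : b ≤ c) : b = c :=
  le_antisymm h (hc.2 hb.1 h)

theorem finite_Iic (p : G.UnfoldingTree R) : (Set.Iic p).Finite := by
  refine Set.Finite.of_finite_image (f := Subtype.val) ?_ Subtype.val_injective.injOn
  refine (List.finite_toSet p.1.inits).subset ?_
  rintro _ ⟨q, hq, rfl⟩
  exact (List.mem_inits _ _).2 hq

theorem IsCofiniteSubspace.finite_basis (hG : G.RowFinite) {S : Set (G.UnfoldingTree R)}
    (hS : IsCofiniteSubspace S) : (basis S).Finite := by
  have hfin : ({[]} ∪ ⋃ p ∈ Sᶜ, (fun e => p.1 ++ [e]) '' {e | G.o e = p.terminus} :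
      Set (List E)).Finite :=
    (Set.finite_singleton _).union (hS.finite_compl.biUnion fun p _ => (hG p.terminus).image _)
  refine Set.Finite.of_finite_image (f := Subtype.val) (hfin.subset ?_)
    Subtype.val_injective.injOn
  rintro _ ⟨b, hb, rfl⟩
  rcases List.eq_nil_or_concat' b.1 with h | ⟨l, e, h⟩
  · exact Or.inl h
  · have hw := b.2
    rw [h, isWalk_append] at hw
    refine Or.inr (Set.mem_iUnion₂.2 ⟨⟨l, hw.1⟩, fun hl => ?_, e, hw.2.1, h.symm⟩)
    have hle : b ≤ ⟨l, hw.1⟩ := hb.2 hl ⟨[e], h.symm⟩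
    have := List.IsPrefix.length_le hle
    rw [h] at this
    simp at this

/-- The vertices of the tree that are not proper prefixes of a given one form a cofinite
subspace. -/
theorem IsCofiniteSubspace.not_lt (p : G.UnfoldingTree R) :
    IsCofiniteSubspace {q : G.UnfoldingTree R | ¬ q < p} where
  finite_compl := (finite_Iic p).subset fun q hq => (not_not.1 hq).le
  mem_of_le q hq r hqr h := hq (lt_of_le_of_lt hqr h)
  inescapable q := by
    by_cases h : q < p
    · exact ⟨p, lt_irrefl p, h.le⟩
    · exact ⟨q, h, le_rfl⟩

end UnfoldingTree

namespace LeavittPathAlgebra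

/-! ### Cofinite subspaces and the unit of the rooted algebra -/

/-- A vertex of the unfolding tree, as an element of the Leavitt path algebra. -/
noncomputable def treeWalk (p : G.UnfoldingTree R) : G.LeavittPathAlgebra := walk G R p.1

theorem edge_mul_terminus (e : E) : edge G e * vertex G (G.t e) = edge G e :=
  ofFree_eq_of_rel (.edge_mul_terminus e)

theorem vertex_eq_sum (hG : G.RowFinite) {v : V} (hv : ∃ e, G.o e = v) :
    vertex G v = ∑ e ∈ (hG v).toFinset, edge G e * star (edge G e) := by
  have h := ofFree_eq_of_rel (LeavittRel.vertex_eq_sum (G := G) v (hG v).toFinset (by simp)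
    (by simpa [Set.Nonempty] using hv))
  rw [map_sum] at h
  refine h.trans (Finset.sum_congr rfl fun e _ => ?_)
  rw [map_mul, edge, star_ofFree, star_gen]
  rfl

theorem treeWalk_root : treeWalk (root G R) = vertex G R := rfl

theorem vertex_mul_treeWalk (p : G.UnfoldingTree R) : vertex G R * treeWalk p = treeWalk p :=
  vertex_mul_walk p.2

theorem treeWalk_extend (p : G.UnfoldingTree R) {w : List E} (h : G.IsWalk p.terminus w) :
    treeWalk (p.extend w h) = treeWalk p * walk G p.terminus w :=
  walk_append (p.extend w h).2

theorem treeWalk_mul_terminus (p : G.UnfoldingTree R) :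
    treeWalk p * vertex G p.terminus = treeWalk p := by
  refine (treeWalk_extend p (w := []) trivial).symm.trans ?_
  exact congrArg (walk G R) (List.append_nil p.1)

theorem star_treeWalk_mul_extend (p : G.UnfoldingTree R) {w : List E}
    (h : G.IsWalk p.terminus w) :
    star (treeWalk p) * treeWalk (p.extend w h) = walk G p.terminus w :=
  star_walk_mul_walk_append (p.extend w h).2

theorem star_treeWalk_mul_eq_zero {p q : G.UnfoldingTree R} (hpq : ¬ p ≤ q) (hqp : ¬ q ≤ p) :
    star (treeWalk p) * treeWalk q = 0 := by
  rcases star_walk_mul_walk p.2 q.2 with ⟨r, h, -⟩ | ⟨r, h, -⟩ | h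
  · exact absurd ⟨r, h.symm⟩ hpq
  · exact absurd ⟨r, h.symm⟩ hqp
  · exact h

theorem treeWalk_mul_star_mem_rooted {p q : G.UnfoldingTree R} (h : p.terminus = q.terminus) :
    treeWalk p * star (treeWalk q) ∈ rooted G R :=
  Submodule.subset_span ⟨p, q, h, rfl⟩

theorem vertex_mem_rooted (G : DirectedMultigraph V E) (R : V) : vertex G R ∈ rooted G R := by
  have h := treeWalk_mul_star_mem_rooted (G := G) (R := R) (p := root G R) rfl
  rwa [treeWalk_root, star_vertex, vertex_mul_self] at h

theorem vertex_mul_of_mem_rooted {x : G.LeavittPathAlgebra} (hx : x ∈ rooted G R) :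
    vertex G R * x = x := by
  change x ∈ Submodule.span ℤ (rootedGenerators G R) at hx
  induction hx using Submodule.span_induction with
  | zero => exact mul_zero _
  | add x y _ _ hx hy => rw [mul_add, hx, hy]
  | smul n x _ hx => rw [mul_smul_comm, hx]
  | mem x hx =>
    obtain ⟨p, q, -, rfl⟩ := hx
    rw [← mul_assoc, vertex_mul_walk p.2]

theorem mul_vertex_of_mem_rooted {x : G.LeavittPathAlgebra} (hx : x ∈ rooted G R) :
    x * vertex G R = x := by
  have h := vertex_mul_of_mem_rooted (star_mem hx)
  rw [← star_star (x * vertex G R), star_mul, star_vertex, h, star_star]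

/-- Right multiplication by the walks in a cofinite subspace is jointly injective. The Cuntz–Krieger
relations propagate vanishing from the children of a vertex of the tree to the vertex, and
there are finitely many vertices outside of the subspace. -/
theorem mul_vertex_eq_zero (hG : G.RowFinite) {S : Set (G.UnfoldingTree R)}
    (hS : IsCofiniteSubspace S) {x : G.LeavittPathAlgebra}
    (hx : ∀ q ∈ S, x * treeWalk q = 0) : x * vertex G R = 0 := by
  obtain ⟨N, hN⟩ := (hS.finite_compl.image fun p => p.1.length).bddAbove
  have key : ∀ (n : ℕ) (p : G.UnfoldingTree R), N < p.1.length + n → x * treeWalk p = 0 := by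
    intro n
    induction n with
    | zero =>
      intro p hp
      by_contra h
      have := hN ⟨p, fun hpS => h (hx p hpS), rfl⟩
      simp only at this
      omega
    | succ n ih =>
      intro p hp
      by_cases hpS : p ∈ S
      · exact hx p hpS
      have hv : ∃ e, G.o e = p.terminus := by
        obtain ⟨s, hs, hps⟩ := hS.inescapable p
        obtain ⟨w, hw, rfl⟩ := exists_extend_eq hps
        cases w with
        | nil =>
          refine absurd ?_ hpS
          convert hs
          exact Subtype.ext (List.append_nil _).symm
        | cons e w => exact ⟨e, hw.1⟩
      rw [← treeWalk_mul_terminus, vertex_eq_sum hG hv, Finset.mul_sum, Finset.mul_sum]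
      refine Finset.sum_eq_zero fun e he => ?_
      have hw : G.IsWalk p.terminus [e] := ⟨by simpa using he, trivial⟩
      have h1 : treeWalk p * edge G e = treeWalk (p.extend [e] hw) := by
        rw [treeWalk_extend, walk, walk, edge_mul_terminus]
      rw [← mul_assoc (treeWalk p), h1, ← mul_assoc, ih, zero_mul]
      change N < (p.1 ++ [e]).length + n
      rw [List.length_append, List.length_singleton]
      omega
  have := key (N + 1) (root G R) (by omega)
  rwa [treeWalk_root] at this

theorem eq_of_mul_treeWalk_eq (hG : G.RowFinite) {S : Set (G.UnfoldingTree R)}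
    (hS : IsCofiniteSubspace S) {x y : G.LeavittPathAlgebra} (hx : x ∈ rooted G R)
    (hy : y ∈ rooted G R) (h : ∀ q ∈ S, x * treeWalk q = y * treeWalk q) : x = y := by
  rw [← sub_eq_zero, ← mul_vertex_of_mem_rooted (sub_mem hx hy)]
  exact mul_vertex_eq_zero hG hS fun q hq => by rw [sub_mul, h q hq, sub_self]

/-- Evaluation of a sum `∑ g b (f b)*` over independent walks `f b` on an extension of one of
them. -/
theorem sum_mul_treeWalk_extend {B : Finset (G.UnfoldingTree R)}
    {f : G.UnfoldingTree R → G.UnfoldingTree R}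
    (hf : ∀ b ∈ B, ∀ c ∈ B, f b ≤ f c → b = c) (g : G.UnfoldingTree R → G.LeavittPathAlgebra)
    {b : G.UnfoldingTree R} (hb : b ∈ B) {w : List E} (hw : G.IsWalk (f b).terminus w) :
    (∑ c ∈ B, g c * star (treeWalk (f c))) * treeWalk ((f b).extend w hw) =
      g b * walk G (f b).terminus w := by
  rw [Finset.sum_mul, Finset.sum_eq_single b]
  · rw [mul_assoc, star_treeWalk_mul_extend]
  · intro c hc hcb
    rw [treeWalk_extend, mul_assoc, ← mul_assoc (star (treeWalk (f c))),
      star_treeWalk_mul_eq_zero, zero_mul, mul_zero]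
    · exact fun h => hcb (hf c hc b hb h)
    · exact fun h => hcb (hf b hb c hc h).symm
  · exact fun h => absurd hb h

/-- The basis of a cofinite subspace decomposes the unit of the rooted algebra. -/
theorem sum_basis_eq_vertex (hG : G.RowFinite) {S : Set (G.UnfoldingTree R)}
    (hS : IsCofiniteSubspace S) :
    ∑ b ∈ (hS.finite_basis hG).toFinset, treeWalk b * star (treeWalk b) = vertex G R := by
  refine eq_of_mul_treeWalk_eq hG hS (sum_mem fun b _ => treeWalk_mul_star_mem_rooted rfl)
    (vertex_mem_rooted G R) fun q hq => ?_
  obtain ⟨b, hb, hbq⟩ := exists_basis_le hq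
  obtain ⟨w, hw, rfl⟩ := exists_extend_eq hbq
  rw [vertex_mul_treeWalk, treeWalk_extend]
  refine (congrArg _ (treeWalk_extend b hw)).symm.trans
    (sum_mul_treeWalk_extend (f := id) ?_ treeWalk ((Set.Finite.mem_toFinset _).2 hb) hw)
  intro c hc d hd
  rw [Set.Finite.mem_toFinset] at hc hd
  exact eq_of_mem_basis_of_le hc hd

/-- The rooted Leavitt path algebra is unital: its unit is the root of the graph. The instance is
scoped, so that outside of this namespace the rooted algebra keeps its non-unital structure. -/
noncomputable scoped instance rootedRing : Ring (rooted G R) :=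
  { (inferInstance : NonUnitalRing (rooted G R)) with
    one := ⟨vertex G R, vertex_mem_rooted G R⟩
    one_mul := fun x => Subtype.ext (vertex_mul_of_mem_rooted x.2)
    mul_one := fun x => Subtype.ext (mul_vertex_of_mem_rooted x.2) }

noncomputable scoped instance rootedStarRing : StarRing (rooted G R) :=
  { (inferInstance : Star (rooted G R)) with
    star_involutive := fun x => Subtype.ext (star_star x.1)
    star_mul := fun x y => Subtype.ext (star_mul x.1 y.1)
    star_add := fun x y => Subtype.ext (star_add x.1 y.1) }

/-! ### Elements that implement almost automorphisms -/

/-- The element `u` implements the almost automorphism `h` if left multiplication by `u` acts on the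
walks in some cofinite subspace as a representative of `h` does. -/
def Implements (u : rooted G R) (h : G.AlmostAut R) : Prop :=
  ∃ φ : Representative G R, AlmostAut.mk φ = h ∧ ∃ S, IsCofiniteSubspace S ∧ S ⊆ φ.source ∧
    ∀ q ∈ S, u.1 * treeWalk q = treeWalk (φ.toPartialEquiv q)

theorem implements_one : Implements (1 : rooted G R) 1 :=
  ⟨Representative.one G R, rfl, _, IsCofiniteSubspace.univ, le_rfl,
    fun q _ => vertex_mul_treeWalk q⟩

theorem Implements.mul {x y : rooted G R} {h k : G.AlmostAut R} (hx : Implements x h)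
    (hy : Implements y k) : Implements (x * y) (h * k) := by
  obtain ⟨φ, rfl, S, hS, hSφ, hxS⟩ := hx
  obtain ⟨ψ, rfl, T, hT, hTψ, hyT⟩ := hy
  refine ⟨φ.mul ψ, rfl, _, (ψ.cofinite_preimage hS).inter hT, ?_, fun q hq => ?_⟩
  · intro q hq
    change q ∈ (ψ.toPartialEquiv.trans φ.toPartialEquiv).source
    rw [PartialEquiv.trans_source]
    exact ⟨hq.1.1, hSφ hq.1.2⟩
  · change x.1 * y.1 * _ = _
    rw [mul_assoc, hyT q hq.2, hxS _ hq.1.2]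
    rfl

theorem Implements.unique (hG : G.RowFinite) {x y : rooted G R} {h : G.AlmostAut R}
    (hx : Implements x h) (hy : Implements y h) : x = y := by
  obtain ⟨φ, rfl, S, hS, -, hxS⟩ := hx
  obtain ⟨ψ, hψ, T, hT, -, hyT⟩ := hy
  obtain ⟨U, hU, -, -, hUe⟩ := AlmostAut.mk_eq_mk.1 hψ
  refine Subtype.ext (eq_of_mul_treeWalk_eq hG ((hS.inter hT).inter hU) x.2 y.2 fun q hq => ?_)
  rw [hxS q hq.1.1, hyT q hq.1.2, hUe hq.2]

/-- The element `∑ φ(b) b*` over the basis of the domain implements a Higman–Thompson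
representative `φ`, and its adjoint implements the inverse. -/
theorem exists_implements (hG : G.RowFinite) {h : G.AlmostAut R} (hh : h ∈ G.HigmanThompson R) :
    ∃ x : rooted G R, Implements x h ∧ Implements (star x) h⁻¹ := by
  obtain ⟨φ, hφ, rfl⟩ := hh
  have hB := φ.source_cofinite.finite_basis hG
  have hterm : ∀ b ∈ hB.toFinset, (φ.toPartialEquiv b).terminus = b.terminus := fun b hb =>
    (hφ b (hB.mem_toFinset.1 hb)).1
  have hext : ∀ b ∈ basis φ.source, ∀ w (hw : G.IsWalk b.terminus w)
      (hw' : G.IsWalk (φ.toPartialEquiv b).terminus w),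
      φ.toPartialEquiv (b.extend w hw) = (φ.toPartialEquiv b).extend w hw' :=
    fun b hb w hw hw' => Subtype.ext ((hφ b hb).2 w _ rfl)
  have hind : ∀ b ∈ hB.toFinset, ∀ c ∈ hB.toFinset, b ≤ c → b = c := fun b hb c hc =>
    eq_of_mem_basis_of_le (hB.mem_toFinset.1 hb) (hB.mem_toFinset.1 hc)
  refine ⟨⟨∑ b ∈ hB.toFinset, treeWalk (φ.toPartialEquiv b) * star (treeWalk b),
    sum_mem fun b hb => treeWalk_mul_star_mem_rooted (hterm b hb)⟩,
    ⟨φ, rfl, _, φ.source_cofinite, le_rfl, fun q hq => ?_⟩,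
    ⟨φ.inv, rfl, _, φ.target_cofinite, le_rfl, fun q hq => ?_⟩⟩
  · obtain ⟨b, hb, hbq⟩ := exists_basis_le hq
    obtain ⟨w, hw, rfl⟩ := exists_extend_eq hbq
    have hbB := hB.mem_toFinset.2 hb
    have hw' := hw
    rw [← hterm b hbB] at hw'
    rw [hext b hb w hw hw', treeWalk_extend (φ.toPartialEquiv b), hterm b hbB]
    exact sum_mul_treeWalk_extend (f := id) hind _ hbB hw
  · obtain ⟨p, hp, rfl⟩ : ∃ p ∈ φ.source, φ.toPartialEquiv p = q :=
      ⟨_, φ.map_target hq, φ.right_inv hq⟩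
    have hinv : φ.inv.toPartialEquiv (φ.toPartialEquiv p) = p := φ.left_inv hp
    obtain ⟨b, hb, hbq⟩ := exists_basis_le hp
    obtain ⟨w, hw, rfl⟩ := exists_extend_eq hbq
    have hbB := hB.mem_toFinset.2 hb
    have hw' := hw
    rw [← hterm b hbB] at hw'
    rw [hinv, hext b hb w hw hw', treeWalk_extend b]
    change star (∑ b ∈ hB.toFinset, treeWalk (φ.toPartialEquiv b) * star (treeWalk b)) * _ = _
    simp only [star_sum, star_mul, star_star]
    rw [sum_mul_treeWalk_extend (f := φ.toPartialEquiv) _ treeWalk hbB hw', hterm b hbB]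
    intro c hc d hd hcd
    exact hind c hc d hd
      ((φ.map_le_iff c (hB.mem_toFinset.1 hc).1 d (hB.mem_toFinset.1 hd).1).1 hcd)

theorem exists_unitary_implements (hG : G.RowFinite) {h : G.AlmostAut R}
    (hh : h ∈ G.HigmanThompson R) : ∃ x : unitary (rooted G R), Implements x.1 h := by
  obtain ⟨x, hx, hx'⟩ := exists_implements hG hh
  refine ⟨⟨x, Unitary.mem_iff.2 ⟨?_, ?_⟩⟩, hx⟩
  · exact Implements.unique hG (inv_mul_cancel h ▸ hx'.mul hx) implements_one
  · exact Implements.unique hG (mul_inv_cancel h ▸ hx.mul hx') implements_one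

/-- The embedding of the Higman–Thompson group into the unitary group of the rooted Leavitt path
algebra. -/
noncomputable def toUnitary (hG : G.RowFinite) (R : V) :
    G.HigmanThompson R →* unitary (rooted G R) where
  toFun h := (exists_unitary_implements hG h.2).choose
  map_one' := Subtype.ext (Implements.unique hG
    (exists_unitary_implements hG (one_mem (G.HigmanThompson R))).choose_spec implements_one)
  map_mul' h k := Subtype.ext (Implements.unique hG
    (exists_unitary_implements hG (h * k).2).choose_spec
    ((exists_unitary_implements hG h.2).choose_spec.mul
      (exists_unitary_implements hG k.2).choose_spec))

theorem implements_toUnitary (hG : G.RowFinite) (h : G.HigmanThompson R) :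
    Implements (toUnitary hG R h).1 h.1 :=
  (exists_unitary_implements hG h.2).choose_spec

/-! ### Unitaries permute walks up to sign -/

/-- On a cofinite subspace, left multiplication by an element of the rooted algebra sends walks to
integer combinations of walks with the same terminus. -/
theorem exists_mul_treeWalk_mem_span {x : G.LeavittPathAlgebra} (hx : x ∈ rooted G R) :
    ∃ S : Set (G.UnfoldingTree R), IsCofiniteSubspace S ∧ ∀ q ∈ S, x * treeWalk q ∈
      Submodule.span ℤ (treeWalk '' {p : G.UnfoldingTree R | p.terminus = q.terminus}) := by
  change x ∈ Submodule.span ℤ (rootedGenerators G R) at hx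
  induction hx using Submodule.span_induction with
  | zero => exact ⟨_, IsCofiniteSubspace.univ, fun q _ => by rw [zero_mul]; exact zero_mem _⟩
  | add x y _ _ hx hy =>
    obtain ⟨S, hS, hxS⟩ := hx
    obtain ⟨T, hT, hyT⟩ := hy
    exact ⟨_, hS.inter hT, fun q hq => by
      rw [add_mul]; exact add_mem (hxS q hq.1) (hyT q hq.2)⟩
  | smul n x _ hx =>
    obtain ⟨S, hS, hxS⟩ := hx
    exact ⟨S, hS, fun q hq => by
      rw [smul_mul_assoc]; exact Submodule.smul_mem _ n (hxS q hq)⟩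
  | mem x hx =>
    obtain ⟨p, r, hpr, rfl⟩ := hx
    refine ⟨_, IsCofiniteSubspace.not_lt r, fun q hq => ?_⟩
    change treeWalk p * star (treeWalk r) * treeWalk q ∈ _
    by_cases hrq : r ≤ q
    · obtain ⟨w, hw, rfl⟩ := exists_extend_eq hrq
      have hw' := hw
      rw [← hpr] at hw'
      rw [mul_assoc, star_treeWalk_mul_extend, ← hpr, ← treeWalk_extend p hw']
      refine Submodule.subset_span ⟨_, ?_, rfl⟩
      rw [Set.mem_ofPred_eq, terminus_extend, terminus_extend, hpr]
    · rw [mul_assoc, star_treeWalk_mul_eq_zero hrq, mul_zero]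
      · exact zero_mem _
      · exact fun h => hq (lt_of_le_not_ge h hrq)

/-- An integer combination of walks with terminus `v` that is an isometry is a walk up to sign: the
sum of the squares of its coefficients is `1`. -/
theorem exists_eq_smul_treeWalk {v : V} {y : G.LeavittPathAlgebra}
    (hy : y ∈ Submodule.span ℤ (treeWalk '' {p : G.UnfoldingTree R | p.terminus = v}))
    (hiso : star y * y = vertex G v) :
    ∃ p : G.UnfoldingTree R, p.terminus = v ∧ ∃ ε : ℤˣ, y = (ε : ℤ) • treeWalk p := by
  obtain ⟨c, hc, rfl⟩ := (Finsupp.mem_span_image_iff_linearCombination ℤ).1 hy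
  rw [Finsupp.mem_supported] at hc
  obtain ⟨ξ, hξ⟩ := BoundaryPath.exists_origin_eq G v
  have hsum : ∑ p ∈ c.support, c p ^ 2 = 1 := by
    have h := congrArg (diagCoeff ξ) hiso
    rw [← hξ, diagCoeff_vertex, Finsupp.linearCombination_apply, Finsupp.sum, star_sum,
      Finset.sum_mul, map_sum] at h
    rw [← h]
    refine Finset.sum_congr rfl fun p hp => ?_
    rw [Finset.mul_sum, map_sum, Finset.sum_eq_single p]
    · rw [star_zsmul, smul_mul_assoc, mul_smul_comm, map_zsmul, map_zsmul, treeWalk,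
        diagCoeff_star_walk_mul_self ((hc hp).trans hξ.symm)]
      simp [sq]
    · intro q _ hqp
      rw [star_zsmul, smul_mul_assoc, mul_smul_comm, map_zsmul, map_zsmul, treeWalk, treeWalk,
        diagCoeff_star_walk_mul_walk_of_ne ξ hqp.symm, smul_zero, smul_zero]
    · exact fun h => absurd hp h
  have hle : (c.support.card : ℤ) ≤ 1 := by
    rw [← hsum, ← nsmul_one, ← Finset.sum_const]
    exact Finset.sum_le_sum fun p hp =>
      Int.add_one_le_of_lt (sq_pos_of_ne_zero (Finsupp.mem_support_iff.1 hp))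
  have hpos : c.support.card ≠ 0 := fun h => by
    rw [Finset.card_eq_zero.1 h] at hsum
    simp at hsum
  obtain ⟨p, hp⟩ := Finset.card_eq_one.1 (show c.support.card = 1 by omega)
  rw [hp, Finset.sum_singleton] at hsum
  refine ⟨p, hc (hp ▸ Finset.mem_singleton_self p),
    (Int.isUnit_iff.2 (sq_eq_one_iff.1 hsum)).unit, ?_⟩
  rw [Finsupp.linearCombination_apply, Finsupp.sum, hp, Finset.sum_singleton, IsUnit.unit_spec]

/-- The element `x` sends the walk `q` to the walk `p`, up to sign, and `p` has the same terminus
as `q`. -/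
def SendsWalk (x : rooted G R) (q p : G.UnfoldingTree R) : Prop :=
  p.terminus = q.terminus ∧ ∃ ε : ℤˣ, x.1 * treeWalk q = (ε : ℤ) • treeWalk p

theorem SendsWalk.unique {x : rooted G R} {q p p' : G.UnfoldingTree R} (h : SendsWalk x q p)
    (h' : SendsWalk x q p') : p = p' := by
  obtain ⟨ht, ε, h⟩ := h
  obtain ⟨-, ε', h'⟩ := h'
  by_contra hpp
  obtain ⟨ξ, hξ⟩ := BoundaryPath.exists_origin_eq G p.terminus
  have hd := congrArg (fun y => diagCoeff ξ (star (treeWalk p) * y)) (h.symm.trans h')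
  simp only [mul_smul_comm, map_zsmul] at hd
  rw [treeWalk, treeWalk, diagCoeff_star_walk_mul_self hξ.symm,
    diagCoeff_star_walk_mul_walk_of_ne ξ hpp] at hd
  simp at hd

theorem SendsWalk.adjoint {x : rooted G R} (hx : x ∈ unitary (rooted G R)) {q p : G.UnfoldingTree R}
    (h : SendsWalk x q p) : SendsWalk (star x) p q := by
  obtain ⟨ht, ε, h⟩ := h
  refine ⟨ht.symm, ε, ?_⟩
  have hx' : star x.1 * x.1 = vertex G R := congrArg Subtype.val (Unitary.mem_iff.1 hx).1
  have h1 : star x.1 * (x.1 * treeWalk q) = treeWalk q := by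
    rw [← mul_assoc, hx', vertex_mul_treeWalk]
  rw [h, mul_smul_comm] at h1
  rw [← h1, smul_smul, ← Units.val_mul, Int.units_mul_self, Units.val_one, one_smul]
  rfl

theorem SendsWalk.extend {x : rooted G R} {q p : G.UnfoldingTree R} (h : SendsWalk x q p)
    {w : List E} (hq : G.IsWalk q.terminus w) (hp : G.IsWalk p.terminus w) :
    SendsWalk x (q.extend w hq) (p.extend w hp) := by
  obtain ⟨ht, ε, h⟩ := h
  refine ⟨by rw [terminus_extend, terminus_extend, ht], ε, ?_⟩
  rw [treeWalk_extend, treeWalk_extend, ← mul_assoc, h, smul_mul_assoc, ht]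

theorem exists_sendsWalk {x : rooted G R} (hx : x ∈ unitary (rooted G R)) :
    ∃ S : Set (G.UnfoldingTree R), IsCofiniteSubspace S ∧ ∀ q ∈ S, ∃ p, SendsWalk x q p := by
  obtain ⟨S, hS, h⟩ := exists_mul_treeWalk_mem_span x.2
  refine ⟨S, hS, fun q hq => exists_eq_smul_treeWalk (h q hq) ?_⟩
  have hx' : star x.1 * x.1 = vertex G R := congrArg Subtype.val (Unitary.mem_iff.1 hx).1
  rw [star_mul, mul_assoc, ← mul_assoc (star x.1), hx', vertex_mul_treeWalk]
  exact star_walk_mul_self q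

/-- A unitary permutes the walks of suitable cofinite subspaces, up to sign, as some
Higman–Thompson representative does. The image of the domain is cofinite because the adjoint
has the same property. -/
theorem exists_representative_sendsWalk {x : rooted G R} (hx : x ∈ unitary (rooted G R)) :
    ∃ φ : Representative G R, φ.IsHigmanThompson ∧
      ∀ q ∈ φ.source, SendsWalk x q (φ.toPartialEquiv q) := by
  obtain ⟨S, hS, hxS⟩ := exists_sendsWalk hx
  have hx' := Unitary.star_mem hx
  obtain ⟨T, hT, hxT⟩ := exists_sendsWalk hx'
  have : Nonempty (G.UnfoldingTree R) := ⟨root G R⟩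
  choose! f hf using hxS
  choose! g hg using hxT
  have hf' : ∀ {q p}, q ∈ S → SendsWalk (star x) p q → f q = p := fun hq h => by
    have h' := h.adjoint hx'
    rw [star_star] at h'
    exact (hf _ hq).unique h'
  have hinj : Set.InjOn f S := fun q hq q' hq' h => by
    have h1 := (hf q hq).adjoint hx
    rw [h] at h1
    exact h1.unique ((hf q' hq').adjoint hx)
  have hginj : Set.InjOn g T := fun q hq q' hq' h => by
    have h1 := (hg q hq).adjoint hx'
    rw [h] at h1
    exact h1.unique ((hg q' hq').adjoint hx')
  have hext : ∀ q ∈ S, ∀ w (hw : G.IsWalk q.terminus w) (hw' : G.IsWalk (f q).terminus w),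
      f (q.extend w hw) = (f q).extend w hw' := fun q hq w hw hw' =>
    (hf _ (hS.mem_of_le q hq _ (q.le_extend hw))).unique ((hf q hq).extend hw hw')
  have htarget : IsCofiniteSubspace (f '' S) :=
    { finite_compl := by
        have hfin : {s | s ∈ T ∧ g s ∉ S}.Finite :=
          Set.Finite.of_finite_image (f := g)
            (hS.finite_compl.subset (by rintro _ ⟨s, hs, rfl⟩; exact hs.2))
            (hginj.mono fun s hs => hs.1)
        refine (hT.finite_compl.union hfin).subset fun s hs => ?_
        by_cases hsT : s ∈ T
        · exact Or.inr ⟨hsT, fun h => hs ⟨g s, h, hf' h (hg s hsT)⟩⟩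
        · exact Or.inl hsT
      mem_of_le := by
        rintro _ ⟨q, hq, rfl⟩ s hs
        obtain ⟨w, hw, rfl⟩ := exists_extend_eq hs
        have hw' := hw
        rw [(hf q hq).1] at hw'
        exact ⟨q.extend w hw', hS.mem_of_le q hq _ (q.le_extend hw'), hext q hq w hw' hw⟩
      inescapable := fun s => by
        obtain ⟨t, ht, hst⟩ := hT.inescapable s
        obtain ⟨q, hq, hgq⟩ := hS.inescapable (g t)
        obtain ⟨w, hw, rfl⟩ := exists_extend_eq hgq
        have hw' := hw
        rw [(hg t ht).1] at hw'
        refine ⟨t.extend w hw', ⟨_, hq, hf' hq ((hg t ht).extend hw' hw)⟩,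
          hst.trans (t.le_extend hw')⟩ }
  let φ : Representative G R :=
    { toPartialEquiv := hinj.bijOn_image.toPartialEquiv f S (f '' S)
      source_cofinite := hS
      target_cofinite := htarget
      map_le_iff := fun p hp q hq => by
        refine ⟨fun h => ?_, fun h => ?_⟩
        · change f p ≤ f q at h
          obtain ⟨w, hw, h⟩ := exists_extend_eq h
          have hw' := hw
          rw [(hf p hp).1] at hw'
          rw [← hext p hp w hw' hw] at h
          rw [hinj hq (hS.mem_of_le p hp _ (p.le_extend hw')) h]
          exact p.le_extend hw'
        · change f p ≤ f q
          obtain ⟨w, hw, rfl⟩ := exists_extend_eq h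
          have hw' := hw
          rw [← (hf p hp).1] at hw'
          rw [hext p hp w hw hw']
          exact le_extend _ hw' }
  refine ⟨φ, fun b hb => ⟨(hf b hb.1).1, fun w q hq => ?_⟩, hf⟩
  obtain ⟨w', hw, rfl⟩ := exists_extend_eq (p := b) (q := q) ⟨w, hq.symm⟩
  obtain rfl : w' = w := List.append_cancel_left hq
  have hw' := hw
  rw [← (hf b hb.1).1] at hw'
  exact congrArg Subtype.val (hext b hb.1 w' hw hw')

/-- An element of the rooted algebra that sends the walks in a cofinite subspace to even multiples
of walks is even. -/
theorem even_of_mul_treeWalk (hG : G.RowFinite) {S : Set (G.UnfoldingTree R)}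
    (hS : IsCofiniteSubspace S) {x : rooted G R}
    (h : ∀ q ∈ S, ∃ p : G.UnfoldingTree R, p.terminus = q.terminus ∧
      ∃ n : ℤ, x.1 * treeWalk q = (n + n) • treeWalk p) : Even x := by
  have : Nonempty (G.UnfoldingTree R) := ⟨root G R⟩
  choose! f hf n hn using h
  have hB := hS.finite_basis hG
  refine ⟨⟨∑ b ∈ hB.toFinset, n b • (treeWalk (f b) * star (treeWalk b)), sum_mem fun b hb =>
    SMulMemClass.smul_mem _ (treeWalk_mul_star_mem_rooted (hf b (hB.mem_toFinset.1 hb).1))⟩, ?_⟩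
  refine Subtype.ext ?_
  change x.1 = ∑ b ∈ hB.toFinset, _ + ∑ b ∈ hB.toFinset, _
  rw [← mul_vertex_of_mem_rooted x.2, ← sum_basis_eq_vertex hG hS, Finset.mul_sum,
    ← Finset.sum_add_distrib]
  refine Finset.sum_congr rfl fun b hb => ?_
  rw [← mul_assoc, hn b (hB.mem_toFinset.1 hb).1, smul_mul_assoc, add_smul]

end LeavittPathAlgebra

end DirectedMultigraph

/-! ### Unitaries modulo two -/

/-- The group of unitaries of a star ring that are congruent to `1` modulo `2`. -/
def unitaryModTwo (A : Type*) [Ring A] [StarRing A] : Subgroup (unitary A) where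
  carrier := {x | Even ((x : A) - 1)}
  one_mem' := by simp
  mul_mem' {x y} hx hy := by
    have : ((x * y : unitary A) : A) - 1 = ((x : A) - 1) * y + ((y : A) - 1) := by
      simp only [Submonoid.coe_mul]; noncomm_ring
    change Even _
    rw [this]
    exact (hx.mul_right _).add hy
  inv_mem' {x} hx := by
    have : ((x⁻¹ : unitary A) : A) - 1 = -(((x⁻¹ : unitary A) : A) * ((x : A) - 1)) := by
      rw [mul_sub, ← Submonoid.coe_mul, inv_mul_cancel]; simp
    change Even _
    rw [this]
    exact (hx.mul_left _).neg

theorem mem_unitaryModTwo {A : Type*} [Ring A] [StarRing A] {x : unitary A} :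
    x ∈ unitaryModTwo A ↔ Even ((x : A) - 1) := Iff.rfl

instance normal_unitaryModTwo (A : Type*) [Ring A] [StarRing A] : (unitaryModTwo A).Normal where
  conj_mem x hx y := by
    have : ((y * x * y⁻¹ : unitary A) : A) - 1 =
        (y : A) * ((x : A) - 1) * ((y⁻¹ : unitary A) : A) := by
      rw [mul_sub, sub_mul, mul_one, ← Submonoid.coe_mul, ← Submonoid.coe_mul, ← Submonoid.coe_mul,
        mul_inv_cancel]; simp
    rw [mem_unitaryModTwo, this]
    exact (Even.mul_left hx _).mul_right _

theorem inv_mul_mem_unitaryModTwo_iff {A : Type*} [Ring A] [StarRing A] {x y : unitary A} :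
    x⁻¹ * y ∈ unitaryModTwo A ↔ Even ((y : A) - x) := by
  have h1 : (y : A) - x = x * (((x⁻¹ * y : unitary A) : A) - 1) := by
    rw [mul_sub, ← Submonoid.coe_mul, mul_inv_cancel_left, mul_one]
  have h2 : ((x⁻¹ * y : unitary A) : A) - 1 = ((x⁻¹ : unitary A) : A) * ((y : A) - x) := by
    rw [mul_sub, ← Submonoid.coe_mul, ← Submonoid.coe_mul, inv_mul_cancel]; rfl
  rw [mem_unitaryModTwo]
  exact ⟨fun h => h1 ▸ h.mul_left _, fun h => h2 ▸ h.mul_left _⟩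

/-- The isomorphism of unitary groups induced by a star ring isomorphism. -/
def unitaryCongr {A B : Type*} [Ring A] [StarRing A] [Ring B] [StarRing B] (e : A ≃⋆+* B) :
    unitary A ≃* unitary B :=
  (Unitary.mapEquiv ⟨e.toRingEquiv.toMulEquiv, map_star e⟩).toMulEquiv

theorem map_mem_unitaryModTwo {A B : Type*} [Ring A] [StarRing A] [Ring B] [StarRing B]
    (e : A ≃⋆+* B) {x : unitary A} (hx : x ∈ unitaryModTwo A) :
    unitaryCongr e x ∈ unitaryModTwo B := by
  have h : Even (e ((x : A) - 1)) := hx.map e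
  rwa [map_sub, map_one] at h

/-- A star ring isomorphism induces an isomorphism of the unitary groups modulo two. -/
noncomputable def unitaryModTwoCongr {A B : Type*} [Ring A] [StarRing A] [Ring B] [StarRing B]
    (e : A ≃⋆+* B) : unitary A ⧸ unitaryModTwo A ≃* unitary B ⧸ unitaryModTwo B :=
  QuotientGroup.congr _ _ (unitaryCongr e) <| by
    refine le_antisymm ?_ fun y hy => ?_
    · rintro _ ⟨x, hx, rfl⟩
      exact map_mem_unitaryModTwo e hx
    · exact ⟨_, map_mem_unitaryModTwo e.symm hy,
        (unitaryCongr e).apply_symm_apply y⟩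

namespace DirectedMultigraph.LeavittPathAlgebra

universe u v

variable {V : Type u} {E : Type v} {G : DirectedMultigraph V E}

open UnfoldingTree

/-- The Higman–Thompson group is the unitary group of the rooted Leavitt path algebra modulo two. -/
theorem bijective_toUnitary_modTwo (hG : G.RowFinite) (R : V) :
    Function.Bijective ((QuotientGroup.mk' (unitaryModTwo (rooted G R))).comp (toUnitary hG R)) := by
  refine ⟨(injective_iff_map_eq_one _).2 fun h hh => ?_, fun y => ?_⟩
  · have hmem : Even ((toUnitary hG R h).1 - 1) :=
      mem_unitaryModTwo.1 ((QuotientGroup.eq_one_iff _).1 hh)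
    obtain ⟨φ, hφ, S, hS, hSφ, hu⟩ := implements_toUnitary hG h
    refine Subtype.ext (hφ.symm.trans (AlmostAut.mk_eq_mk.2
      ⟨S, hS, hSφ, fun _ _ => trivial, fun q hq => ?_⟩))
    change φ.toPartialEquiv q = q
    by_contra hne
    obtain ⟨x, hx⟩ := hmem
    obtain ⟨ξ, hξ⟩ := BoundaryPath.exists_origin_eq G q.terminus
    -- Modulo two, `q* φ(q)` agrees with `q* q`, but their diagonal coefficients are `0` and `1`.
    have h1 : treeWalk (φ.toPartialEquiv q) - treeWalk q = (x.1 + x.1) * treeWalk q := by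
      rw [← hu q hq]
      conv_lhs => rw [← vertex_mul_treeWalk q, ← mul_assoc,
        mul_vertex_of_mem_rooted (Subtype.prop _), ← sub_mul]
      exact congrArg (· * treeWalk q) (congrArg Subtype.val hx)
    have h2 := congrArg (fun y => diagCoeff ξ (star (treeWalk q) * y)) h1
    simp only [mul_sub, add_mul, mul_add, map_sub, map_add] at h2
    rw [treeWalk, treeWalk, diagCoeff_star_walk_mul_self hξ.symm,
      diagCoeff_star_walk_mul_walk_of_ne ξ (Ne.symm hne)] at h2
    omega
  · obtain ⟨x, rfl⟩ := QuotientGroup.mk'_surjective _ y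
    obtain ⟨φ, hφ, hx⟩ := exists_representative_sendsWalk x.2
    refine ⟨⟨AlmostAut.mk φ, φ, hφ, rfl⟩, (QuotientGroup.eq).2 ?_⟩
    rw [inv_mul_mem_unitaryModTwo_iff]
    obtain ⟨ψ, hψ, S, hS, hSψ, hu⟩ := implements_toUnitary hG (R := R) ⟨AlmostAut.mk φ, φ, hφ, rfl⟩
    obtain ⟨T, hT, hTψ, hTφ, hTe⟩ := AlmostAut.mk_eq_mk.1 hψ
    refine even_of_mul_treeWalk hG (hS.inter hT) fun q hq => ?_
    obtain ⟨ht, ε, hε⟩ := hx q (hTφ hq.2)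
    refine ⟨φ.toPartialEquiv q, ht, ?_⟩
    have hsub : (x.1 - (toUnitary hG R ⟨AlmostAut.mk φ, φ, hφ, rfl⟩).1).1 * treeWalk q =
        ((ε : ℤ) - 1) • treeWalk (φ.toPartialEquiv q) := by
      rw [sub_smul, one_smul, ← hε, ← hTe hq.2, ← hu q hq.1]
      exact sub_mul _ _ _
    rw [hsub]
    rcases Int.units_eq_one_or ε with rfl | rfl
    · exact ⟨0, rfl⟩
    · exact ⟨-1, rfl⟩

/-- The Higman–Thompson group as the unitary group of the rooted Leavitt path algebra modulo two. -/
noncomputable def higmanThompsonEquiv (hG : G.RowFinite) (R : V) :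
    G.HigmanThompson R ≃* unitary (rooted G R) ⧸ unitaryModTwo (rooted G R) :=
  MulEquiv.ofBijective _ (bijective_toUnitary_modTwo hG R)

end DirectedMultigraph.LeavittPathAlgebra

theorem theorem1 {V : Type*} {E : Type*} {V' : Type*} {E' : Type*}
    (G : DirectedMultigraph V E) (R : V) (hG : G.RowFinite) (hR : G.IsRoot R)
    (H : DirectedMultigraph V' E') (S : V') (hH : H.RowFinite) (hS : H.IsRoot S)
    (φ : DirectedMultigraph.LeavittPathAlgebra.rooted G R ≃⋆ₐ[ℤ]
      DirectedMultigraph.LeavittPathAlgebra.rooted H S) :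
    Nonempty (G.HigmanThompson R ≃* H.HigmanThompson S) := by
  open scoped DirectedMultigraph.LeavittPathAlgebra in
  exact ⟨(DirectedMultigraph.LeavittPathAlgebra.higmanThompsonEquiv hG R).trans
    ((unitaryModTwoCongr
      { φ with
        map_mul' := fun x y => map_mul φ x y
        map_add' := fun x y => map_add φ x y
        map_star' := fun x => map_star φ x }).trans
      (DirectedMultigraph.LeavittPathAlgebra.higmanThompsonEquiv hH S).symm)⟩
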